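/- There exists an infinite-dimensional complex Banach algebra $A$ (that is, a complex algebra, not assumed to have a unit, with a complete submultiplicative norm) that is chaotic: there is $a\in A$ such that both sets $$\{z a^n : z\in\mathbb{C},\ n\in\mathbb{N}\}\qquad\text{and}\qquad \{(\mathbf{1}+a)^n a : n\in\mathbb{N}\}$$ are dense in $A$. Here $\mathbb{N}=\{1,2,3,\dots\}$ and $\mathbf{1}$ is the unit of the unitization $A\oplus\mathbb{C}\mathbf{1}$. Moreover, $A$ can be taken commutative, without a unit, and equal to the completion of the algebra $z\mathbb{C}[z]$ of complex polynomials vanishing at $0$ with respect to some submultiplicative norm $\pi$ on $z\mathbb{C}[z]$, with $a=z$. -/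

import Mathlib

open Polynomial

section Chaotic

variable {A : Type*} [NonUnitalNormedRing A] [NormedSpace ℂ A]
  [IsScalarTower ℂ A A] [SMulCommClass ℂ A A]

/-- `a` is a supercyclic element of `A`: the set `{z aⁿ : z ∈ ℂ, n ≥ 1}` is dense in `A`.
Powers are computed in the unitization `A ⊕ ℂ𝟏`, in which `A` sits through `Unitization.inr`
(for `n ≥ 1` the elements `z aⁿ` lie in `A`). -/
def IsSupercyclicElement (a : A) : Prop :=
  Dense {x : A | ∃ (z : ℂ) (n : ℕ), 1 ≤ n ∧
    (Unitization.inr x : Unitization ℂ A) = z • (Unitization.inr a : Unitization ℂ A) ^ n}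

/-- `a` is an almost hypercyclic element of `A`: the set `{(𝟏 + a)ⁿ a : n ≥ 1}` is dense
in `A`, where `𝟏` is the unit of the unitization `A ⊕ ℂ𝟏`. -/
def IsAlmostHypercyclicElement (a : A) : Prop :=
  Dense {x : A | ∃ n : ℕ, 1 ≤ n ∧
    (Unitization.inr x : Unitization ℂ A) =
      (1 + (Unitization.inr a : Unitization ℂ A)) ^ n * Unitization.inr a}

/-- `a` is a chaotic element of `A`. -/
def IsChaoticElement (a : A) : Prop :=
  IsSupercyclicElement a ∧ IsAlmostHypercyclicElement a

end Chaotic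

/-- The non-unital algebra `zℂ[z]` of complex polynomials vanishing at `0`. -/
def polyZero : NonUnitalSubalgebra ℂ ℂ[X] where
  carrier := {p | p.eval 0 = 0}
  zero_mem' := by simp
  add_mem' := by
    intro p q hp hq
    simp only [Set.mem_ofPred_eq] at hp hq ⊢
    rw [eval_add, hp, hq, add_zero]
  mul_mem' := by
    intro p q hp _
    simp only [Set.mem_ofPred_eq] at hp ⊢
    rw [eval_mul, hp, zero_mul]
  smul_mem' := by
    intro c p hp
    simp only [Set.mem_ofPred_eq] at hp ⊢
    rw [eval_smul, hp, smul_zero]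

/-- The polynomial `z`, as an element of `zℂ[z]`. -/
noncomputable def polyZ : polyZero := ⟨X, eval_X⟩

/-! The norm is a limit of seminorms `ρ k` on `ℂ[X]`, each a norm on a truncation `ℂ[X] / (X ^ d
k)`. Passing from `ρ k` to `ρ (k + 1)` brings one multiple of a power of `X` and one `X (1 + X) ^ n`
close to a prescribed target. Old values of polynomials vanishing at `0` never increase, and
decrease at most by factors whose product stays below `2`. The limit is therefore a norm, and
listing a countable dense set of targets with all tolerances makes `X` chaotic.

The key step is `IsTruncated.eventually_exists_perturbation`. To make `w = v - q` small, adjoin a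
variable `Y` of size `θ` and give `p` the least cost of an `F(X, Y)` with `F(X, w) = p` modulo a
high power of `X`; the cost is the maximum of `ρ (F(X, 0))` and a weighted `ℓ¹` norm. Then `Y`
represents `w`, and `p` represents itself. The danger is that `p` becomes too cheap. Put `H(X, Y) =
F(X, Y - q) - p`: then `H(X, v)` vanishes to high order, and `H(X, q) = F(X, 0) - p` must be shown
small for `ρ`. As `X ∣ q`, only coefficients of `H` of total degree below `d` matter.

These are small when `v = X Pₙ(n X)` with `Pₙ → E` coefficientwise. Replacing `X` by `X / n` scales
the coefficient at `(a, b)` by `n ^ (-(a + b))`, so the high-degree terms are negligible, while the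
low-degree ones multiply nearly independent series `X ^ (a + b) E ^ b`; see
`IndepBelow.exists_low_coeff_bound`. Taking `E = X ^ d` gives multiples of `X ^ (d + 1)`, and `E =
exp`, the limit of `(1 + X / n) ^ n`, gives `X (1 + X) ^ n`.

A unit would give a character `χ`, and the numbers `(1 + χ a) ^ n * χ a` are never dense in `ℂ`. -/

/-! ### Weighted `ℓ¹` seminorms on polynomials in one and two variables. -/

section WeightedSum
open scoped NNReal

/-- Submultiplicativity of a seminorm on an algebra. -/
def Seminorm.Submul {R : Type*} [Ring R] [Algebra ℂ R] (N : Seminorm ℂ R) : Prop :=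
  ∀ x y, N (x * y) ≤ N x * N y

theorem Seminorm.map_sum_le {R ι : Type*} [AddCommGroup R] [Module ℂ R] (N : Seminorm ℂ R)
    (s : Finset ι) (f : ι → R) : N (∑ i ∈ s, f i) ≤ ∑ i ∈ s, N (f i) :=
  Finset.le_sum_of_subadditive N (map_zero N).le (map_add_le_add N) s f

variable {R : Type*} [CommRing R] [Algebra ℂ R]

/-- The weighted `ℓ¹` sum `∑ N(pᵢ) μⁱ` of a polynomial `p = ∑ pᵢ Xⁱ`. -/
noncomputable def weightedSum (N : Seminorm ℂ R) (μ : ℝ≥0) (p : R[X]) : ℝ :=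
  p.sum fun i c => N c * μ ^ i

theorem weightedSum_eq_sum_range (N : Seminorm ℂ R) (μ : ℝ≥0) {p : R[X]} {n : ℕ}
    (hn : p.natDegree < n) :
    weightedSum N μ p = ∑ i ∈ Finset.range n, N (p.coeff i) * (μ : ℝ) ^ i :=
  p.sum_over_range' (fun _ => by simp) n hn

/-- The weighted `ℓ¹` seminorm on polynomials over a seminormed algebra. -/
noncomputable def polyL1 (N : Seminorm ℂ R) (μ : ℝ≥0) : Seminorm ℂ R[X] :=
  Seminorm.of (weightedSum N μ)
    (by
      intro p q
      set n := max p.natDegree q.natDegree + 1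
      rw [weightedSum_eq_sum_range N μ (p := p + q) (n := n)
          (Nat.lt_succ_of_le (natDegree_add_le p q)),
        weightedSum_eq_sum_range N μ (p := p) (n := n) (Nat.lt_succ_of_le (le_max_left _ _)),
        weightedSum_eq_sum_range N μ (p := q) (n := n) (Nat.lt_succ_of_le (le_max_right _ _)),
        ← Finset.sum_add_distrib]
      refine Finset.sum_le_sum fun i _ => ?_
      rw [coeff_add, ← add_mul]
      exact mul_le_mul_of_nonneg_right (map_add_le_add N _ _) (by positivity))
    (by
      intro c p
      rw [weightedSum_eq_sum_range N μ (p := c • p) (n := p.natDegree + 1)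
          (Nat.lt_succ_of_le (natDegree_smul_le c p)),
        weightedSum_eq_sum_range N μ (p := p) (n := p.natDegree + 1) (Nat.lt_succ_self _),
        Finset.mul_sum]
      refine Finset.sum_congr rfl fun i _ => ?_
      rw [coeff_smul, map_smul_eq_mul, mul_assoc])

theorem polyL1_eq_sum_range (N : Seminorm ℂ R) (μ : ℝ≥0) {p : R[X]} {n : ℕ}
    (hn : p.natDegree < n) :
    polyL1 N μ p = ∑ i ∈ Finset.range n, N (p.coeff i) * (μ : ℝ) ^ i :=
  weightedSum_eq_sum_range N μ hn

@[simp]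
theorem polyL1_monomial (N : Seminorm ℂ R) (μ : ℝ≥0) (i : ℕ) (c : R) :
    polyL1 N μ (monomial i c) = N c * (μ : ℝ) ^ i :=
  sum_monomial_index c (fun i c => N c * (μ : ℝ) ^ i) (by simp)

@[simp]
theorem polyL1_C (N : Seminorm ℂ R) (μ : ℝ≥0) (c : R) : polyL1 N μ (C c) = N c := by
  rw [← monomial_zero_left, polyL1_monomial, pow_zero, mul_one]

@[simp]
theorem polyL1_X (N : Seminorm ℂ R) (μ : ℝ≥0) : polyL1 N μ X = N 1 * μ := by
  rw [X, polyL1_monomial, pow_one]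

theorem coeff_mul_pow_le_polyL1 (N : Seminorm ℂ R) (μ : ℝ≥0) (p : R[X]) (i : ℕ) :
    N (p.coeff i) * (μ : ℝ) ^ i ≤ polyL1 N μ p := by
  rw [polyL1_eq_sum_range N μ (n := max p.natDegree i + 1)
    (Nat.lt_succ_of_le (le_max_left _ _))]
  exact Finset.single_le_sum (f := fun i => N (p.coeff i) * (μ : ℝ) ^ i)
    (fun j _ => by positivity) (Finset.mem_range.2 (Nat.lt_succ_of_le (le_max_right _ _)))

theorem polyL1_mono {N N' : Seminorm ℂ R} {μ μ' : ℝ≥0} (hN : N ≤ N') (hμ : μ ≤ μ') :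
    polyL1 N μ ≤ polyL1 N' μ' := by
  intro p
  change polyL1 N μ p ≤ polyL1 N' μ' p
  rw [polyL1_eq_sum_range N μ (Nat.lt_succ_self p.natDegree),
    polyL1_eq_sum_range N' μ' (Nat.lt_succ_self p.natDegree)]
  refine Finset.sum_le_sum fun i _ => ?_
  have := hN (p.coeff i)
  gcongr

/-- A seminorm dominated by the weighted `ℓ¹` seminorm on monomials is dominated everywhere. -/
theorem map_le_polyL1 {S : Type*} [CommRing S] [Algebra ℂ S] (N : Seminorm ℂ R) (μ : ℝ≥0)
    (ν : Seminorm ℂ S) (hν : ν.Submul) (φ : R[X] →+* S) (hC : ∀ c, ν (φ (C c)) ≤ N c)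
    (hX : ν (φ X) ≤ μ) (p : R[X]) : ν (φ p) ≤ polyL1 N μ p := by
  have hmon : ∀ (c : R) (i : ℕ), ν (φ (C c * X ^ i)) ≤ N c * (μ : ℝ) ^ i := by
    intro c i
    induction i with
    | zero => simpa using hC c
    | succ i ih =>
      rw [pow_succ, ← mul_assoc, map_mul, pow_succ, ← mul_assoc]
      exact (hν _ _).trans (mul_le_mul ih hX (apply_nonneg _ _) (by positivity))
  conv_lhs => rw [p.as_sum_range_C_mul_X_pow]
  rw [polyL1_eq_sum_range N μ (Nat.lt_succ_self p.natDegree), map_sum]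
  refine (ν.map_sum_le _ _).trans (Finset.sum_le_sum fun i _ => hmon _ _)

theorem polyL1_submul {N : Seminorm ℂ R} (hN : N.Submul) (μ : ℝ≥0) : (polyL1 N μ).Submul := by
  intro p q
  have hmon : ∀ (c : R) (i : ℕ), polyL1 N μ (monomial i c * q) ≤
      N c * (μ : ℝ) ^ i * polyL1 N μ q := by
    intro c i
    conv_lhs => rw [q.as_sum_range, Finset.mul_sum]
    refine (Seminorm.map_sum_le _ _ _).trans ?_
    rw [polyL1_eq_sum_range N μ (Nat.lt_succ_self q.natDegree), Finset.mul_sum]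
    refine Finset.sum_le_sum fun j _ => ?_
    rw [monomial_mul_monomial, polyL1_monomial, pow_add]
    calc _ ≤ N c * N (q.coeff j) * ((μ : ℝ) ^ i * (μ : ℝ) ^ j) :=
          mul_le_mul_of_nonneg_right (hN _ _) (by positivity)
      _ = _ := by ring
  conv_lhs => rw [p.as_sum_range, Finset.sum_mul]
  refine (Seminorm.map_sum_le _ _ _).trans ?_
  rw [polyL1_eq_sum_range N μ (Nat.lt_succ_self p.natDegree), Finset.sum_mul]
  exact Finset.sum_le_sum fun i _ => hmon _ _

/-- The weighted `ℓ¹` norm on `ℂ[X]`. -/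
noncomputable def cL1 (μ : ℝ≥0) : Seminorm ℂ ℂ[X] := polyL1 (normSeminorm ℂ ℂ) μ

theorem cL1_submul (μ : ℝ≥0) : (cL1 μ).Submul :=
  polyL1_submul (fun x y => (norm_mul x y).le) μ

theorem coeff_mul_pow_le_cL1 (μ : ℝ≥0) (p : ℂ[X]) (i : ℕ) :
    ‖p.coeff i‖ * (μ : ℝ) ^ i ≤ cL1 μ p :=
  coeff_mul_pow_le_polyL1 (normSeminorm ℂ ℂ) μ p i

theorem cL1_eq_sum_range (μ : ℝ≥0) {p : ℂ[X]} {n : ℕ} (hn : p.natDegree < n) :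
    cL1 μ p = ∑ i ∈ Finset.range n, ‖p.coeff i‖ * (μ : ℝ) ^ i :=
  polyL1_eq_sum_range (normSeminorm ℂ ℂ) μ hn

theorem cL1_mono {μ μ' : ℝ≥0} (h : μ ≤ μ') (p : ℂ[X]) : cL1 μ p ≤ cL1 μ' p :=
  polyL1_mono le_rfl h p

/-- Without a constant term every monomial carries at least one factor `μ`, so small weights make
the norm small. This is why constant terms are excluded throughout. -/
theorem cL1_le_mul_of_coeff_zero {μ : ℝ≥0} (hμ : μ ≤ 1) {p : ℂ[X]} (hp : p.coeff 0 = 0) :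
    cL1 μ p ≤ μ * cL1 1 p := by
  rw [cL1_eq_sum_range μ (Nat.lt_succ_self p.natDegree),
    cL1_eq_sum_range 1 (Nat.lt_succ_self p.natDegree), Finset.mul_sum]
  refine Finset.sum_le_sum fun i _ => ?_
  rcases i with _ | i
  · simp [hp]
  · have h : (μ : ℝ) ^ (i + 1) ≤ μ := by
      rw [pow_succ]
      exact mul_le_of_le_one_left μ.2 (pow_le_one₀ μ.2 hμ)
    calc _ ≤ ‖p.coeff (i + 1)‖ * μ := mul_le_mul_of_nonneg_left h (norm_nonneg _)
      _ = _ := by simp [mul_comm]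

/-- The weighted `ℓ¹` norm on `ℂ[X][Y]`, with weight `η` on `X` and `θ` on `Y`. -/
noncomputable def biL1 (η θ : ℝ≥0) : Seminorm ℂ ℂ[X][X] := polyL1 (cL1 η) θ

theorem biL1_submul (η θ : ℝ≥0) : (biL1 η θ).Submul := polyL1_submul (cL1_submul η) θ

theorem coeff_coeff_mul_le_biL1 (η θ : ℝ≥0) (F : ℂ[X][X]) (a b : ℕ) :
    ‖(F.coeff b).coeff a‖ * (η : ℝ) ^ a * (θ : ℝ) ^ b ≤ biL1 η θ F :=
  (mul_le_mul_of_nonneg_right (coeff_mul_pow_le_cL1 η _ a) (by positivity)).trans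
    (coeff_mul_pow_le_polyL1 (cL1 η) θ F b)

theorem cL1_eval_le_biL1 {μ η θ : ℝ≥0} (hμ : μ ≤ η) {w : ℂ[X]} (hw : cL1 μ w ≤ θ)
    (F : ℂ[X][X]) : cL1 μ (F.eval w) ≤ biL1 η θ F := by
  refine map_le_polyL1 (cL1 η) θ (cL1 μ) (cL1_submul μ) (evalRingHom w) (fun c => ?_) ?_ F
  · simpa using cL1_mono hμ c
  · simpa using hw

theorem cL1_one (μ : ℝ≥0) : cL1 μ 1 = 1 := by
  rw [← C_1, cL1, polyL1_C]; simp

/-- The shift `Y ↦ Y - q` is contractive once the weights shrink enough to leave room for `q`. -/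
theorem biL1_comp_le_biL1 {η η' θ θ' : ℝ≥0} (hη : η' ≤ η) {q : ℂ[X]}
    (hq : θ' + cL1 η' q ≤ θ) (F : ℂ[X][X]) :
    biL1 η' θ' (F.comp (X - C q)) ≤ biL1 η θ F := by
  refine map_le_polyL1 (cL1 η) θ (biL1 η' θ') (biL1_submul η' θ') (compRingHom (X - C q))
    (fun c => ?_) ?_ F
  · simpa [biL1] using cL1_mono hη c
  · refine le_trans ?_ hq
    simpa [biL1, cL1_one] using map_sub_le_add (biL1 η' θ') X (C q)

end WeightedSum

/-! ### Quotient seminorms. -/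

/-- The seminorm is the infimum of `c` over representatives. Products of near-optimal
representatives represent products modulo `I`, which gives submultiplicativity. -/
theorem exists_quotient_seminorm {W T : Type*} [CommRing W] [Algebra ℂ W] [CommRing T]
    [Algebra ℂ T] (c : Seminorm ℂ W) (hc : c.Submul) (φ : W →ₐ[ℂ] T) (I : Ideal T)
    (hφ : ∀ t, ∃ w, φ w - t ∈ I) :
    ∃ ν : Seminorm ℂ T, ν.Submul ∧ (∀ w t, φ w - t ∈ I → ν t ≤ c w) ∧
      ∀ t, ∀ e > 0, ∃ w, φ w - t ∈ I ∧ c w < ν t + e := by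
  set f : T → ℝ := fun t => sInf (c '' {w | φ w - t ∈ I}) with hf
  have hbdd : ∀ t, BddBelow (c '' {w | φ w - t ∈ I}) := fun t =>
    ⟨0, by rintro _ ⟨w, -, rfl⟩; exact apply_nonneg c w⟩
  have hne : ∀ t, (c '' {w | φ w - t ∈ I}).Nonempty := fun t => by
    obtain ⟨w, hw⟩ := hφ t
    exact ⟨_, w, hw, rfl⟩
  have hle : ∀ w t, φ w - t ∈ I → f t ≤ c w := fun w t hw => csInf_le (hbdd t) ⟨w, hw, rfl⟩
  have hlt : ∀ t, ∀ e > 0, ∃ w, φ w - t ∈ I ∧ c w < f t + e := by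
    intro t e he
    obtain ⟨_, ⟨w, hw, rfl⟩, h⟩ := exists_lt_of_csInf_lt (hne t) (lt_add_of_pos_right (f t) he)
    exact ⟨w, hw, h⟩
  have h0 : ∀ t, 0 ≤ f t := fun t =>
    le_csInf (hne t) (by rintro _ ⟨w, -, rfl⟩; exact apply_nonneg c w)
  have hzero : f 0 = 0 := le_antisymm (by simpa using hle 0 0 (by simp)) (h0 0)
  have hadd : ∀ s t, f (s + t) ≤ f s + f t := by
    intro s t
    refine le_of_forall_pos_le_add fun e he => ?_
    obtain ⟨x, hx, hx'⟩ := hlt s (e / 2) (half_pos he)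
    obtain ⟨y, hy, hy'⟩ := hlt t (e / 2) (half_pos he)
    have h := hle (x + y) (s + t) (by
      have := I.add_mem hx hy
      rwa [map_add, add_sub_add_comm])
    linarith [map_add_le_add c x y]
  have hsmul : ∀ (z : ℂ) t, f (z • t) ≤ ‖z‖ * f t := by
    intro z t
    refine le_of_forall_pos_le_add fun e he => ?_
    have hz : 0 < ‖z‖ + 1 := by positivity
    obtain ⟨x, hx, hx'⟩ := hlt t (e / (‖z‖ + 1)) (by positivity)
    have h := hle (z • x) (z • t) (by
      rw [map_smul, ← smul_sub, ← algebraMap_smul T z]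
      exact I.mul_mem_left _ hx)
    rw [map_smul_eq_mul] at h
    have h1 : ‖z‖ * c x ≤ ‖z‖ * (f t + e / (‖z‖ + 1)) :=
      mul_le_mul_of_nonneg_left hx'.le (norm_nonneg z)
    have h2 : ‖z‖ * (e / (‖z‖ + 1)) ≤ e := by
      rw [mul_div_assoc', div_le_iff₀ hz]
      nlinarith [norm_nonneg z]
    linarith
  refine ⟨Seminorm.ofSMulLE f hzero hadd hsmul, ?_, hle, hlt⟩
  intro s t
  change f (s * t) ≤ f s * f t
  have key : ∀ e > 0, f (s * t) ≤ (f s + e) * (f t + e) := by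
    intro e he
    obtain ⟨x, hx, hx'⟩ := hlt s e he
    obtain ⟨y, hy, hy'⟩ := hlt t e he
    have h := hle (x * y) (s * t) (by
      have h1 := I.add_mem (I.mul_mem_right (φ y) hx) (I.mul_mem_left s hy)
      have h2 : (φ x - s) * φ y + s * (φ y - t) = φ (x * y) - s * t := by
        rw [map_mul]; ring
      rwa [h2] at h1)
    exact (h.trans (hc x y)).trans
      (mul_le_mul hx'.le hy'.le (apply_nonneg c y) (by linarith [h0 s]))
  have hlim : Filter.Tendsto (fun e : ℝ => (f s + e) * (f t + e)) (nhdsWithin 0 (Set.Ioi 0))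
      (nhds ((f s + 0) * (f t + 0))) := by
    refine Filter.Tendsto.mono_left ?_ nhdsWithin_le_nhds
    exact Continuous.tendsto (by fun_prop) 0
  rw [add_zero, add_zero] at hlim
  exact ge_of_tendsto hlim (Filter.eventually_of_mem self_mem_nhdsWithin key)

/-! ### Stability of linear independence under perturbation. -/

section UniformIndependence
open Filter Topology

/-- The relations valid on the first `M` coordinates form a decreasing chain of subspaces of a
finite-dimensional space. It stabilizes, necessarily at the relations valid everywhere. -/
theorem LinearIndependent.exists_truncation {ι : Type*} [Fintype ι] {u : ι → ℕ → ℂ}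
    (hu : LinearIndependent ℂ u) :
    ∃ M : ℕ, LinearIndependent ℂ fun t => fun i : Fin M => u t i := by
  classical
  let T : ℕ → Submodule ℂ (ι → ℂ) := fun M =>
    { carrier := {x | ∀ i < M, ∑ t, x t * u t i = 0}
      add_mem' := by
        intro x y hx hy i hi
        simp only [Pi.add_apply, add_mul, Finset.sum_add_distrib, hx i hi, hy i hi, add_zero]
      zero_mem' := by intro i _; simp
      smul_mem' := by
        intro c x hx i hi
        simp only [Pi.smul_apply, smul_eq_mul, mul_assoc, ← Finset.mul_sum, hx i hi, mul_zero] }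
  have hT : Antitone T := fun M N h x hx i hi => hx i (hi.trans_le h)
  obtain ⟨M, hM⟩ := IsArtinian.monotone_stabilizes
    (⟨fun M => OrderDual.toDual (T M), fun _ _ h => hT h⟩ : ℕ →o (Submodule ℂ (ι → ℂ))ᵒᵈ)
  refine ⟨M, Fintype.linearIndependent_iff.2 fun g hg => ?_⟩
  have hgM : g ∈ T M := by
    intro i hi
    simpa using congrFun hg ⟨i, hi⟩
  refine Fintype.linearIndependent_iff.1 hu g ?_
  ext i
  have h1 : T M = T (max M (i + 1)) := hM _ (le_max_left _ _)
  rw [h1] at hgM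
  simpa using hgM i (lt_of_lt_of_le (Nat.lt_succ_self i) (le_max_right _ _))

/-- Linear independence of a finite family of sequences persists, with uniform bounds on the
coefficients, under coordinatewise perturbation. -/
theorem LinearIndependent.exists_uniform_bound {ι : Type*} [Fintype ι] {u : ι → ℕ → ℂ}
    (hu : LinearIndependent ℂ u) {v : ℕ → ι → ℕ → ℂ}
    (hv : ∀ t i, Tendsto (fun n => v n t i) atTop (𝓝 (u t i))) :
    ∃ (M : ℕ) (K : ℝ), 0 ≤ K ∧ ∀ᶠ n in atTop, ∀ (x : ι → ℂ) (B : ℝ), 0 ≤ B →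
      (∀ i < M, ‖∑ t, x t * v n t i‖ ≤ B) → ∀ t, ‖x t‖ ≤ K * B := by
  classical
  obtain ⟨M, hM⟩ := hu.exists_truncation
  let T : (ι → ℂ) →ₗ[ℂ] (Fin M → ℂ) := Fintype.linearCombination ℂ fun t => fun i : Fin M => u t i
  have hT : ∀ x i, T x i = ∑ t, x t * u t i := fun x i => by
    simp [T, Fintype.linearCombination_apply]
  have hker : LinearMap.ker T = ⊥ := by
    rw [LinearMap.ker_eq_bot']
    exact fun x hx => funext (Fintype.linearIndependent_iff.1 hM x hx)
  obtain ⟨G, hG⟩ := T.exists_leftInverse_of_injective hker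
  obtain ⟨C, hC0, hC⟩ := (LinearMap.toContinuousLinearMap G).bound
  -- With this `δ` the perturbation contributes at most `‖x‖ / 2` after applying the left inverse
  -- `G`, and is absorbed.
  have hδ : 0 < 1 / (2 * C * (Fintype.card ι + 1)) := by positivity
  set δ := 1 / (2 * C * (Fintype.card ι + 1)) with hδdef
  refine ⟨M, 2 * C, by positivity, ?_⟩
  have hev : ∀ᶠ n in atTop, ∀ t, ∀ i : Fin M, ‖v n t i - u t i‖ ≤ δ := by
    rw [eventually_all]
    intro t
    rw [eventually_all]
    intro i
    have h := (hv t i).sub_const (u t i)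
    rw [sub_self] at h
    filter_upwards [h.norm.eventually_lt_const (by simpa using hδ)] with n hn using hn.le
  filter_upwards [hev] with n hn x B hB hx
  have h1 : ‖T x‖ ≤ B + Fintype.card ι * (δ * ‖x‖) := by
    refine (pi_norm_le_iff_of_nonneg (by positivity)).2 fun i => ?_
    have h2 : T x i = ∑ t, x t * v n t i - ∑ t, x t * (v n t i - u t i) := by
      rw [hT, ← Finset.sum_sub_distrib]
      exact Finset.sum_congr rfl fun t _ => by ring
    rw [h2]
    refine (norm_sub_le _ _).trans (add_le_add (hx i i.2) ?_)
    refine (norm_sum_le _ _).trans ?_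
    have h3 : ∀ t ∈ Finset.univ, ‖x t * (v n t i - u t i)‖ ≤ δ * ‖x‖ := by
      intro t _
      rw [norm_mul, mul_comm]
      exact mul_le_mul (hn t i) (norm_le_pi_norm x t) (norm_nonneg _) hδ.le
    simpa using Finset.sum_le_card_nsmul _ _ _ h3
  have h4 : G (T x) = x := LinearMap.congr_fun hG x
  have h5 : ‖x‖ ≤ C * ‖T x‖ := by simpa [h4] using hC (T x)
  have h6 : C * (Fintype.card ι * (δ * ‖x‖)) ≤ ‖x‖ / 2 := by
    have h7 : C * (Fintype.card ι * δ) ≤ 1 / 2 := by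
      rw [hδdef, mul_one_div, mul_div_assoc', div_le_div_iff₀ (by positivity) (by norm_num)]
      nlinarith
    calc _ = C * (Fintype.card ι * δ) * ‖x‖ := by ring
      _ ≤ 1 / 2 * ‖x‖ := mul_le_mul_of_nonneg_right h7 (norm_nonneg x)
      _ = _ := by ring
  have h8 : ‖x‖ ≤ 2 * C * B := by nlinarith [mul_le_mul_of_nonneg_left h1 hC0.le]
  exact fun t => (norm_le_pi_norm x t).trans h8

end UniformIndependence

/-! ### Total degree in two variables. -/

section TotalDegree

/-- The exponents `(a, b)` of total degree less than `d`. -/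
def lowIndex (d : ℕ) : Finset (ℕ × ℕ) :=
  (Finset.range d ×ˢ Finset.range d).filter fun t => t.1 + t.2 < d

@[simp]
theorem mem_lowIndex {d : ℕ} {t : ℕ × ℕ} : t ∈ lowIndex d ↔ t.1 + t.2 < d := by
  simp only [lowIndex, Finset.mem_filter, Finset.mem_product, Finset.mem_range]
  omega

/-- Modulo `X ^ D`, only monomials of total degree below `D` contribute to a value `F(X, v)`
with `X ∣ v`. -/
theorem X_pow_dvd_eval_sub_sum_lowIndex {v : ℂ[X]} (hv : X ∣ v) (D : ℕ) (F : ℂ[X][X]) :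
    X ^ D ∣ F.eval v - ∑ t ∈ lowIndex D, C ((F.coeff t.2).coeff t.1) * (X ^ t.1 * v ^ t.2) := by
  induction F using Polynomial.induction_on' with
  | add F G hF hG =>
    simp only [eval_add, coeff_add, C_add, add_mul, Finset.sum_add_distrib]
    rw [add_sub_add_comm]
    exact dvd_add hF hG
  | monomial b f =>
    induction f using Polynomial.induction_on' with
    | add f g hf hg =>
      simp only [map_add, eval_add, coeff_add, add_mul, Finset.sum_add_distrib]
      rw [add_sub_add_comm]
      exact dvd_add hf hg
    | monomial a c =>
      have hterm : ∀ t : ℕ × ℕ, t ≠ (a, b) →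
          C (((monomial b (monomial a c)).coeff t.2).coeff t.1) * (X ^ t.1 * v ^ t.2) = 0 := by
        intro t ht
        rw [coeff_monomial]
        split_ifs with h
        · rw [coeff_monomial, if_neg, C_0, zero_mul]
          rintro rfl
          exact ht (Prod.ext rfl h.symm)
        · simp
      have heval : (monomial b (monomial a c) : ℂ[X][X]).eval v = C c * (X ^ a * v ^ b) := by
        rw [eval_monomial, ← C_mul_X_pow_eq_monomial, mul_assoc]
      by_cases hab : a + b < D
      · rw [Finset.sum_eq_single (a, b) (fun t _ ht => hterm t ht)
          (fun h => absurd (mem_lowIndex.2 hab) h)]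
        rw [heval, coeff_monomial_same, coeff_monomial_same, sub_self]
        exact dvd_zero _
      · rw [Finset.sum_eq_zero, sub_zero, heval]
        · refine Dvd.dvd.mul_left ?_ _
          refine (pow_dvd_pow X (not_lt.1 hab)).trans ?_
          rw [pow_add]
          exact mul_dvd_mul_left _ (pow_dvd_pow_of_dvd hv b)
        · intro t ht
          refine hterm t ?_
          rintro rfl
          exact hab (mem_lowIndex.1 ht)

end TotalDegree

/-! ### Rescaling and smallness of low-degree coefficients. -/

section Rescaling
open Filter Topology
open scoped NNReal

/-- The polynomial `X E(n X)`. -/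
noncomputable def scaledGen (E : ℂ[X]) (n : ℕ) : ℂ[X] := X * E.comp (C (n : ℂ) * X)

theorem X_dvd_scaledGen (E : ℂ[X]) (n : ℕ) : X ∣ scaledGen E n := dvd_mul_right _ _

/-- The substitution `X ↦ n X` turns `X ^ (a + b) * E ^ b` into `n ^ (a + b)` times the left-hand
product. -/
theorem coeff_X_pow_mul_scaledGen_pow (E : ℂ[X]) {n : ℕ} (hn : n ≠ 0) (a b i : ℕ) :
    (X ^ a * scaledGen E n ^ b).coeff i =
      (n : ℂ) ^ i * ((X ^ (a + b) * E ^ b).coeff i / (n : ℂ) ^ (a + b)) := by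
  have hn' : (n : ℂ) ^ (a + b) ≠ 0 := pow_ne_zero _ (Nat.cast_ne_zero.2 hn)
  have h : C ((n : ℂ) ^ (a + b)) * (X ^ a * scaledGen E n ^ b) =
      (X ^ (a + b) * E ^ b).comp (C (n : ℂ) * X) := by
    simp only [scaledGen, mul_comp, pow_comp, X_comp, C_pow]
    ring
  have h2 := congrArg (fun p => p.coeff i) h
  simp only [coeff_C_mul, comp_C_mul_X_coeff] at h2
  rw [mul_div_assoc', eq_div_iff hn', mul_comm, h2, mul_comm]

theorem tendsto_coeff_mul {P Q : ℕ → ℂ[X]} {p q : PowerSeries ℂ}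
    (hP : ∀ j, Tendsto (fun n => (P n).coeff j) atTop (𝓝 (PowerSeries.coeff j p)))
    (hQ : ∀ j, Tendsto (fun n => (Q n).coeff j) atTop (𝓝 (PowerSeries.coeff j q))) (j : ℕ) :
    Tendsto (fun n => (P n * Q n).coeff j) atTop (𝓝 (PowerSeries.coeff j (p * q))) := by
  simp only [coeff_mul, PowerSeries.coeff_mul]
  exact tendsto_finsetSum _ fun x _ => (hP x.1).mul (hQ x.2)

theorem tendsto_coeff_X_pow_mul_pow {P : ℕ → ℂ[X]} {p : PowerSeries ℂ}
    (hP : ∀ j, Tendsto (fun n => (P n).coeff j) atTop (𝓝 (PowerSeries.coeff j p)))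
    (s b j : ℕ) :
    Tendsto (fun n => (X ^ s * P n ^ b).coeff j) atTop
      (𝓝 (PowerSeries.coeff j (PowerSeries.X ^ s * p ^ b))) := by
  refine tendsto_coeff_mul (P := fun _ => X ^ s) (fun i => ?_) (fun i => ?_) j
  · simp [PowerSeries.coeff_X_pow, coeff_X_pow]
  · induction b generalizing i with
    | zero => simp [PowerSeries.coeff_one, coeff_one]
    | succ b ih =>
      simp only [pow_succ]
      exact tendsto_coeff_mul ih hP i

/-- The monomials `X ^ (a + b) E ^ b` with `a + b < d` are linearly independent. -/
def IndepBelow (E : PowerSeries ℂ) (d : ℕ) : Prop :=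
  LinearIndependent ℂ fun t : lowIndex d =>
    (PowerSeries.X ^ (t.1.1 + t.1.2) * E ^ t.1.2 : PowerSeries ℂ)

theorem IndepBelow.coeff {E : PowerSeries ℂ} {d : ℕ} (h : IndepBelow E d) :
    LinearIndependent ℂ fun t : lowIndex d => fun i =>
      PowerSeries.coeff i (PowerSeries.X ^ (t.1.1 + t.1.2) * E ^ t.1.2) := by
  rw [Fintype.linearIndependent_iff]
  intro g hg
  refine Fintype.linearIndependent_iff.1 h g ?_
  ext i
  simpa using congrFun hg i

/-- If `H(X, X Eₙ(n X))` vanishes to high order at `0`, then its coefficients of total degree less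
than `d` are `O(1 / n)` relative to those of total degree at least `d`. -/
theorem IndepBelow.exists_low_coeff_bound {E : PowerSeries ℂ} {d : ℕ} (hE : IndepBelow E d)
    {P : ℕ → ℂ[X]}
    (hP : ∀ j, Tendsto (fun n => (P n).coeff j) atTop (𝓝 (PowerSeries.coeff j E)))
    {η θ : ℝ≥0} (hη : 0 < η) (hθ : 0 < θ) :
    ∃ (M : ℕ) (K : ℝ), 0 ≤ K ∧ ∀ᶠ n : ℕ in atTop, ∀ (H : ℂ[X][X]) (Λ : ℝ), 0 ≤ Λ →
      X ^ M ∣ H.eval (scaledGen (P n) n) →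
      (∀ a b, d ≤ a + b → ‖(H.coeff b).coeff a‖ * (η : ℝ) ^ a * (θ : ℝ) ^ b ≤ Λ) →
      ∀ a b, a + b < d → ‖(H.coeff b).coeff a‖ ≤ K / n * Λ := by
  have hlim := tendsto_coeff_X_pow_mul_pow hP
  obtain ⟨M, K, hK, hev⟩ := hE.coeff.exists_uniform_bound
    (v := fun n t i => (X ^ (t.1.1 + t.1.2) * P n ^ t.1.2).coeff i) (fun t i => hlim _ _ i)
  set D := max M d with hD
  set R : ℝ := ∑ i ∈ Finset.range M, ∑ t ∈ lowIndex D,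
    (‖PowerSeries.coeff i (PowerSeries.X ^ (t.1 + t.2) * E ^ t.2)‖ + 1) /
      ((η : ℝ) ^ t.1 * (θ : ℝ) ^ t.2) with hR
  have hη' : (0 : ℝ) < η := hη
  have hθ' : (0 : ℝ) < θ := hθ
  have hR0 : 0 ≤ R := by positivity
  refine ⟨M, K * R, by positivity, ?_⟩
  have hbd : ∀ᶠ n in atTop, ∀ t ∈ lowIndex D, ∀ i ∈ Finset.range M,
      ‖(X ^ (t.1 + t.2) * P n ^ t.2).coeff i‖ ≤
        ‖PowerSeries.coeff i (PowerSeries.X ^ (t.1 + t.2) * E ^ t.2)‖ + 1 := by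
    rw [eventually_all_finset]
    intro t _
    rw [eventually_all_finset]
    intro i _
    filter_upwards [(hlim (t.1 + t.2) t.2 i).norm.eventually_lt_const (lt_add_one _)] with n hn
      using hn.le
  filter_upwards [hev, hbd, eventually_ge_atTop 1] with n hn hb hn1 H Λ hΛ hdvd hhigh a b hab
  have hn0 : n ≠ 0 := by omega
  have hnR : (1 : ℝ) ≤ n := by exact_mod_cast hn1
  have hnpos : (0 : ℝ) < n := by linarith
  set c : ℕ × ℕ → ℂ := fun t => (H.coeff t.2).coeff t.1 with hc
  set e : ℕ × ℕ → ℕ → ℂ := fun t i => (X ^ (t.1 + t.2) * P n ^ t.2).coeff i with he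
  -- The vanishing of `H(X, X Pₙ(n X))` to order `M`, read after rescaling; the common factor `n ^
  -- i` cancels.
  have hsum : ∀ i < M, ∑ t ∈ lowIndex D, c t / (n : ℂ) ^ (t.1 + t.2) * e t i = 0 := by
    intro i hi
    have h1 := X_pow_dvd_eval_sub_sum_lowIndex (X_dvd_scaledGen (P n) n) D H
    have h2 := X_pow_dvd_iff.1 hdvd i hi
    have h3 := X_pow_dvd_iff.1 h1 i (hi.trans_le (le_max_left _ _))
    rw [coeff_sub, h2, zero_sub, neg_eq_zero, finsetSum_coeff] at h3
    have h4 : (n : ℂ) ^ i ≠ 0 := pow_ne_zero _ (Nat.cast_ne_zero.2 hn0)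
    refine (mul_eq_zero.1 ?_).resolve_left h4
    rw [← h3, Finset.mul_sum]
    refine Finset.sum_congr rfl fun t _ => ?_
    rw [coeff_C_mul, coeff_X_pow_mul_scaledGen_pow _ hn0]
    ring
  have hsub : lowIndex d ⊆ lowIndex D := by
    intro t ht
    rw [mem_lowIndex] at ht ⊢
    exact ht.trans_le (le_max_right _ _)
  have hlow : ∀ i < M, ‖∑ t : lowIndex d, c t / (n : ℂ) ^ (t.1.1 + t.1.2) * e t i‖ ≤
      R * Λ / (n : ℝ) ^ d := by
    intro i hi
    -- The low part is minus the high part, where each coefficient has been divided by at least `n ^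
    -- d`.
    have h1 := Finset.sum_sdiff (f := fun t => c t / (n : ℂ) ^ (t.1 + t.2) * e t i) hsub
    rw [hsum i hi, add_comm] at h1
    rw [Finset.sum_coe_sort (lowIndex d) (fun t => c t / (n : ℂ) ^ (t.1 + t.2) * e t i),
      eq_neg_of_add_eq_zero_left h1, norm_neg]
    refine (norm_sum_le _ _).trans ?_
    have h2 : ∀ t ∈ lowIndex D \ lowIndex d, ‖c t / (n : ℂ) ^ (t.1 + t.2) * e t i‖ ≤
        (‖PowerSeries.coeff i (PowerSeries.X ^ (t.1 + t.2) * E ^ t.2)‖ + 1) /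
          ((η : ℝ) ^ t.1 * (θ : ℝ) ^ t.2) * (Λ / (n : ℝ) ^ d) := by
      intro t ht
      rw [Finset.mem_sdiff, mem_lowIndex (d := d), not_lt] at ht
      have h3 : ‖c t‖ ≤ Λ / ((η : ℝ) ^ t.1 * (θ : ℝ) ^ t.2) := by
        rw [le_div_iff₀ (by positivity), ← mul_assoc]
        exact hhigh _ _ ht.2
      have h4 : ‖e t i‖ ≤ _ := hb t ht.1 i (Finset.mem_range.2 hi)
      have h5 : (n : ℝ) ^ d ≤ (n : ℝ) ^ (t.1 + t.2) := pow_le_pow_right₀ hnR ht.2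
      rw [norm_mul, norm_div, norm_pow, Complex.norm_natCast]
      calc _ ≤ Λ / ((η : ℝ) ^ t.1 * (θ : ℝ) ^ t.2) / (n : ℝ) ^ d *
            (‖PowerSeries.coeff i (PowerSeries.X ^ (t.1 + t.2) * E ^ t.2)‖ + 1) := by gcongr
        _ = _ := by ring
    refine (Finset.sum_le_sum h2).trans ?_
    rw [← Finset.sum_mul, mul_div_assoc]
    refine mul_le_mul_of_nonneg_right ?_ (by positivity)
    refine (Finset.sum_le_sum_of_subset_of_nonneg Finset.sdiff_subset
      (fun t _ _ => by positivity)).trans ?_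
    exact Finset.single_le_sum (f := fun i => ∑ t ∈ lowIndex D,
      (‖PowerSeries.coeff i (PowerSeries.X ^ (t.1 + t.2) * E ^ t.2)‖ + 1) /
        ((η : ℝ) ^ t.1 * (θ : ℝ) ^ t.2)) (fun i _ => by positivity) (Finset.mem_range.2 hi)
  have hfin := hn (fun t => c t / (n : ℂ) ^ (t.1.1 + t.1.2)) (R * Λ / (n : ℝ) ^ d)
    (by positivity) hlow ⟨(a, b), mem_lowIndex.2 hab⟩
  simp only [hc, norm_div, norm_pow, Complex.norm_natCast] at hfin
  rw [div_le_iff₀ (by positivity)] at hfin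
  refine hfin.trans ?_
  -- Since `a + b ≤ d - 1`, a spare factor `n` remains; it is the gain `1 / n`.
  have h6 : (n : ℝ) ^ (a + b) * n ≤ (n : ℝ) ^ d := by
    rw [← pow_succ]
    exact pow_le_pow_right₀ hnR hab
  calc K * (R * Λ / (n : ℝ) ^ d) * (n : ℝ) ^ (a + b)
      = K * R * Λ * ((n : ℝ) ^ (a + b) / (n : ℝ) ^ d) := by ring
    _ ≤ K * R * Λ * (1 / n) := by
        refine mul_le_mul_of_nonneg_left ?_ (by positivity)
        rw [div_le_div_iff₀ (by positivity) hnpos]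
        simpa using h6
    _ = K * R / n * Λ := by ring

end Rescaling

/-! ### Truncated seminorms and their perturbation. -/

section Truncated
open Filter Topology
open scoped NNReal

/-- A submultiplicative seminorm on `ℂ[X]` that induces a norm on `ℂ[X] / (X ^ d)`. -/
structure IsTruncated (d : ℕ) (ρ : Seminorm ℂ ℂ[X]) : Prop where
  submul : ρ.Submul
  map_X_pow_mul : ∀ p, ρ (X ^ d * p) = 0
  exists_coeff_le : ∃ C : ℝ, 0 ≤ C ∧ ∀ p : ℂ[X], ∀ a < d, ‖p.coeff a‖ ≤ C * ρ p

theorem exists_weight_cL1_le {w : ℂ[X]} (hw : w.coeff 0 = 0) {η : ℝ≥0} (hη : 0 < η)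
    (hη1 : η ≤ 1) {θ : ℝ≥0} (hθ : 0 < θ) : ∃ μ : ℝ≥0, 0 < μ ∧ μ ≤ η ∧ cL1 μ w ≤ θ := by
  obtain ⟨c, hc⟩ : ∃ c : ℝ≥0, (c : ℝ) = cL1 1 w := ⟨⟨_, apply_nonneg _ _⟩, rfl⟩
  have hμ : 0 < min η (θ / (c + 1)) := lt_min hη (by positivity)
  refine ⟨min η (θ / (c + 1)), hμ, min_le_left _ _, ?_⟩
  refine (cL1_le_mul_of_coeff_zero ((min_le_left _ _).trans hη1) hw).trans ?_
  rw [← hc, ← NNReal.coe_mul, NNReal.coe_le_coe]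
  calc min η (θ / (c + 1)) * c ≤ θ / (c + 1) * (c + 1) :=
        mul_le_mul' (min_le_right _ _) (le_add_of_nonneg_right zero_le_one)
    _ = θ := div_mul_cancel₀ _ (by positivity)

/-- On a finite-dimensional truncation the `ℓ¹` norm is at most a constant times `ρ`; without
constant term, a small weight `η` absorbs that constant. -/
theorem IsTruncated.exists_weight_cL1_le_map {d : ℕ} {ρ : Seminorm ℂ ℂ[X]}
    (hρ : IsTruncated d ρ) : ∃ η : ℝ≥0, 0 < η ∧ η ≤ 1 ∧
      ∀ p : ℂ[X], p.natDegree < d → p.coeff 0 = 0 → cL1 η p ≤ ρ p := by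
  obtain ⟨C, hC, hle⟩ := hρ.exists_coeff_le
  lift C to ℝ≥0 using hC
  have h1 : (1 + d * C)⁻¹ ≤ 1 := inv_le_one_of_one_le₀ (le_add_of_nonneg_right (by positivity))
  refine ⟨(1 + d * C)⁻¹, by positivity, h1, fun p hp hp0 => ?_⟩
  refine (cL1_le_mul_of_coeff_zero h1 hp0).trans ?_
  have h2 : cL1 1 p ≤ (1 + d * C) * ρ p := by
    rw [cL1_eq_sum_range 1 hp]
    have h3 : ∀ i ∈ Finset.range d, ‖p.coeff i‖ * ((1 : ℝ≥0) : ℝ) ^ i ≤ C * ρ p := by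
      intro i hi
      simpa using hle p i (Finset.mem_range.1 hi)
    refine (Finset.sum_le_card_nsmul _ _ _ h3).trans ?_
    rw [Finset.card_range, nsmul_eq_mul]
    nlinarith [apply_nonneg ρ p]
  rw [NNReal.coe_inv, inv_mul_le_iff₀ (by positivity)]
  exact_mod_cast h2

/-- Evaluation of the second variable, as a `ℂ`-algebra homomorphism. -/
noncomputable def evalAlgHom (w : ℂ[X]) : ℂ[X][X] →ₐ[ℂ] ℂ[X] :=
  (aeval w : ℂ[X][X] →ₐ[ℂ[X]] ℂ[X]).restrictScalars ℂ

@[simp]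
theorem evalAlgHom_apply (w : ℂ[X]) (F : ℂ[X][X]) : evalAlgHom w F = F.eval w := by
  simp [evalAlgHom, coe_aeval_eq_eval]

/-- The larger of `ρ (F(X, 0))` and a weighted `ℓ¹` norm of `F`. -/
noncomputable def costSeminorm (ρ : Seminorm ℂ ℂ[X]) (η θ : ℝ≥0) : Seminorm ℂ ℂ[X][X] :=
  ρ.comp (evalAlgHom 0).toLinearMap ⊔ biL1 η θ

theorem costSeminorm_apply (ρ : Seminorm ℂ ℂ[X]) (η θ : ℝ≥0) (F : ℂ[X][X]) :
    costSeminorm ρ η θ F = max (ρ (F.eval 0)) (biL1 η θ F) := by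
  simp [costSeminorm, Seminorm.sup_apply, Seminorm.comp_apply]

theorem costSeminorm_submul {ρ : Seminorm ℂ ℂ[X]} (hρ : ρ.Submul) (η θ : ℝ≥0) :
    (costSeminorm ρ η θ).Submul := by
  intro F G
  simp only [costSeminorm_apply, eval_mul]
  refine max_le ((hρ _ _).trans ?_) ((biL1_submul η θ F G).trans ?_)
  · exact mul_le_mul (le_max_left _ _) (le_max_left _ _) (apply_nonneg _ _)
      ((apply_nonneg ρ _).trans (le_max_left _ _))
  · exact mul_le_mul (le_max_right _ _) (le_max_right _ _) (apply_nonneg _ _)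
      ((apply_nonneg ρ _).trans (le_max_left _ _))

/-- A truncated seminorm can be perturbed slightly so that `X Pₙ(n X)` becomes close to a
prescribed polynomial `q`. -/
theorem IsTruncated.eventually_exists_perturbation {d : ℕ} {ρ : Seminorm ℂ ℂ[X]}
    (hρ : IsTruncated d ρ) {E : PowerSeries ℂ} (hE : IndepBelow E d) {P : ℕ → ℂ[X]}
    (hP : ∀ j, Tendsto (fun n => (P n).coeff j) atTop (𝓝 (PowerSeries.coeff j E)))
    {q : ℂ[X]} (hq : q.coeff 0 = 0) {θ : ℝ≥0} (hθ : 0 < θ) {δ : ℝ} (hδ : 0 < δ) :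
    ∀ᶠ n : ℕ in atTop, ∀ m : ℕ, ∃ d' ρ', m ≤ d' ∧ IsTruncated d' ρ' ∧
      (∀ p : ℂ[X], p.natDegree < d → p.coeff 0 = 0 → ρ' p ≤ ρ p) ∧
      (∀ p : ℂ[X], p.natDegree < d → ρ p ≤ (1 + δ) * ρ' p) ∧
      ρ' (scaledGen (P n) n - q) ≤ θ := by
  obtain ⟨η, hη, hη1, hηρ⟩ := hρ.exists_weight_cL1_le_map
  -- Half of `θ` is reserved for `q` and half for the new variable, so that `Y ↦ Y - q` is
  -- contractive.
  obtain ⟨η', hη', hη'le, hη'q⟩ := exists_weight_cL1_le hq hη hη1 (half_pos hθ)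
  obtain ⟨M, K, hK, hev⟩ := hE.exists_low_coeff_bound hP hη' (half_pos hθ)
  set S : ℝ := ∑ t ∈ lowIndex d, ρ (X ^ t.1 * q ^ t.2) with hS
  have hS0 : 0 ≤ S := Finset.sum_nonneg fun t _ => apply_nonneg _ _
  have hsmall : ∀ᶠ n : ℕ in atTop, K * S / n < δ :=
    (tendsto_const_div_atTop_nhds_zero_nat (K * S)).eventually_lt_const hδ
  filter_upwards [hev, hsmall] with n hn hnδ m
  set w := scaledGen (P n) n - q with hw
  have hw0 : w.coeff 0 = 0 := by simp [hw, scaledGen, hq]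
  obtain ⟨μ, hμ, hμle, hμw⟩ := exists_weight_cL1_le hw0 hη hη1 hθ
  set d' := max M m with hd'
  -- The second variable is sent to `w`. The parameter `n`, hence `w`, is fixed before `m`, so the
  -- truncation order may later be chosen above the degree of `w`.
  obtain ⟨ρ', hsub, hle, hlt⟩ := exists_quotient_seminorm (costSeminorm ρ η θ)
    (costSeminorm_submul hρ.submul η θ) (evalAlgHom w) (Ideal.span {(X : ℂ[X]) ^ d'})
    (fun t => ⟨C t, by simp⟩)
  simp only [evalAlgHom_apply, Ideal.mem_span_singleton] at hle hlt
  refine ⟨d', ρ', le_max_right _ _, ⟨hsub, fun p => ?_, ?_⟩, fun p hp hp0 => ?_,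
    fun p hp => ?_, ?_⟩
  · refine le_antisymm ?_ (apply_nonneg _ _)
    simpa using hle 0 (X ^ d' * p) (by simp)
  -- Evaluation at `w` is contractive into `cL1 μ` because `cL1 μ w ≤ θ`, so cost controls every
  -- coefficient below `d'`.
  · refine ⟨((μ : ℝ) ^ d')⁻¹, by positivity, fun p a ha => ?_⟩
    refine le_of_forall_pos_le_add fun e he => ?_
    have hμ' : (0 : ℝ) < (μ : ℝ) ^ d' := pow_pos hμ _
    obtain ⟨F, hF, hFc⟩ := hlt p (e * (μ : ℝ) ^ d') (by positivity)
    have h1 : p.coeff a = (F.eval w).coeff a := by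
      have := X_pow_dvd_iff.1 hF a ha
      rw [coeff_sub, sub_eq_zero] at this
      exact this.symm
    have h2 := (coeff_mul_pow_le_cL1 μ (F.eval w) a).trans (cL1_eval_le_biL1 hμle hμw F)
    have h3 : biL1 η θ F ≤ costSeminorm ρ η θ F := by
      rw [costSeminorm_apply]; exact le_max_right _ _
    have h4 : (μ : ℝ) ^ d' ≤ (μ : ℝ) ^ a :=
      pow_le_pow_of_le_one μ.2 (hμle.trans hη1) ha.le
    have h5 : ‖p.coeff a‖ * (μ : ℝ) ^ d' ≤ ρ' p + e * (μ : ℝ) ^ d' := by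
      rw [h1]
      exact (mul_le_mul_of_nonneg_left h4 (norm_nonneg _)).trans ((h2.trans h3).trans hFc.le)
    rw [← sub_le_iff_le_add, inv_mul_eq_div, le_div_iff₀ hμ', sub_mul]
    linarith
  · refine (hle (C p) p (by simp)).trans ?_
    rw [costSeminorm_apply, eval_C, biL1, polyL1_C]
    exact max_le le_rfl (hηρ p hp hp0)
  · refine le_of_forall_pos_le_add fun e he => ?_
    obtain ⟨F, hF, hFc⟩ := hlt p (e / (1 + δ)) (by positivity)
    set Λ := costSeminorm ρ η θ F with hΛ
    have hΛρ : ρ (F.eval 0) ≤ Λ := by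
      rw [hΛ, costSeminorm_apply]; exact le_max_left _ _
    have hΛL : biL1 η θ F ≤ Λ := by
      rw [hΛ, costSeminorm_apply]; exact le_max_right _ _
    have hΛ0 : 0 ≤ Λ := apply_nonneg _ _
    -- `H` measures the gap between `F(X, 0)` and `p`. Subtracting `C p` affects only total degrees
    -- below `d`, so the high coefficients remain bounded by the cost.
    set H : ℂ[X][X] := F.comp (X - C q) - C p with hH
    have hHv : H.eval (scaledGen (P n) n) = F.eval w - p := by
      simp [hH, hw, eval_comp]
    have hHq : H.eval q = F.eval 0 - p := by simp [hH, eval_comp]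
    have hlow := hn H Λ hΛ0 (by rw [hHv]; exact (pow_dvd_pow X (le_max_left _ _)).trans hF) (by
      intro a b hab
      have h0 : ((C p : ℂ[X][X]).coeff b).coeff a = 0 := by
        rw [coeff_C]
        split_ifs with hb
        · exact coeff_eq_zero_of_natDegree_lt (by omega)
        · simp
      rw [hH, coeff_sub, coeff_sub, h0, sub_zero]
      refine (coeff_coeff_mul_le_biL1 η' (θ / 2) _ a b).trans ?_
      refine (biL1_comp_le_biL1 hη'le ?_ F).trans hΛL
      have : ((θ / 2 : ℝ≥0) : ℝ) + ((θ / 2 : ℝ≥0) : ℝ) = θ := by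
        rw [← NNReal.coe_add, add_halves]
      linarith)
    -- As `X ∣ q` and `ρ` kills multiples of `X ^ d`, only the coefficients bounded by `hlow`
    -- contribute.
    have hρH : ρ (H.eval q) ≤ K / n * Λ * S := by
      obtain ⟨r, hr⟩ := X_pow_dvd_eval_sub_sum_lowIndex (X_dvd_iff.2 hq) d H
      rw [sub_eq_iff_eq_add.1 hr]
      refine (map_add_le_add ρ _ _).trans ?_
      rw [hρ.map_X_pow_mul, zero_add, hS, Finset.mul_sum]
      refine (ρ.map_sum_le _ _).trans (Finset.sum_le_sum fun t ht => ?_)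
      rw [← smul_eq_C_mul, map_smul_eq_mul]
      exact mul_le_mul_of_nonneg_right (hlow _ _ (mem_lowIndex.1 ht)) (apply_nonneg _ _)
    have h1 : ρ p ≤ ρ (F.eval 0) + ρ (H.eval q) := by
      have := map_sub_le_add ρ (F.eval 0) (H.eval q)
      rwa [hHq, sub_sub_cancel, ← hHq] at this
    have h2 : K / n * Λ * S ≤ δ * Λ := by
      calc _ = K * S / n * Λ := by ring
        _ ≤ _ := mul_le_mul_of_nonneg_right hnδ.le hΛ0
    have h3 : (1 + δ) * Λ ≤ (1 + δ) * (ρ' p + e / (1 + δ)) :=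
      mul_le_mul_of_nonneg_left hFc.le (by positivity)
    have h4 : (1 + δ) * (ρ' p + e / (1 + δ)) = (1 + δ) * ρ' p + e := by
      field_simp
    linarith
  · refine (hle X w (by simp)).trans ?_
    rw [costSeminorm_apply, eval_X, map_zero, biL1, polyL1_X, cL1_one, one_mul]
    exact max_le θ.2 le_rfl

end Truncated

/-! ### The two limit series `X ^ d` and `exp`. -/

section Families
open Filter Topology
open scoped NNReal

/-- The exponents `a + b + d * b` are pairwise distinct: `a + b < d` is the remainder and `b` the
quotient modulo `d`. -/
theorem indepBelow_X_pow (d : ℕ) : IndepBelow (PowerSeries.X ^ d) d := by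
  rw [IndepBelow, Fintype.linearIndependent_iff]
  intro g hg t
  have h := congrArg (PowerSeries.coeff (t.1.1 + t.1.2 + d * t.1.2)) hg
  simp only [← pow_mul, ← pow_add, map_sum, map_smul, smul_eq_mul, PowerSeries.coeff_X_pow,
    map_zero] at h
  rw [Finset.sum_eq_single t, if_pos rfl, mul_one] at h
  · exact h
  · intro s _ hs
    rw [if_neg, mul_zero]
    intro heq
    apply hs
    have h1 := mem_lowIndex.1 s.2
    have h2 := mem_lowIndex.1 t.2
    have key : ∀ {a b a' b' : ℕ}, a + b < d → a' + b' < d →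
        a + b + d * b = a' + b' + d * b' → b ≤ b' := by
      intro a b a' b' hab hab' he
      by_contra! hlt
      have : d * (b' + 1) ≤ d * b := Nat.mul_le_mul_left d hlt
      rw [mul_add, mul_one] at this
      omega
    have hb : s.1.2 = t.1.2 := le_antisymm (key h1 h2 heq.symm) (key h2 h1 heq)
    have ha : s.1.1 = t.1.1 := by
      rw [hb] at heq
      omega
    exact Subtype.ext (Prod.ext ha hb)
  · exact fun h => absurd (Finset.mem_univ t) h

theorem scaledGen_X_pow (d n : ℕ) : scaledGen (X ^ d) n = C ((n : ℂ) ^ d) * X ^ (d + 1) := by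
  rw [scaledGen, X_pow_comp, mul_pow, C_pow]
  ring

theorem scaledGen_one_add_pow {n : ℕ} (hn : n ≠ 0) :
    scaledGen ((1 + C (n : ℂ)⁻¹ * X) ^ n) n = X * (1 + X) ^ n := by
  have hn' : (n : ℂ) ≠ 0 := Nat.cast_ne_zero.2 hn
  simp only [scaledGen, pow_comp, add_comp, one_comp, mul_comp, C_comp, X_comp]
  rw [← mul_assoc, ← C_mul, inv_mul_cancel₀ hn', C_1, one_mul]

theorem coeff_exp_complex (j : ℕ) :
    PowerSeries.coeff j (PowerSeries.exp ℂ) = (j.factorial : ℂ)⁻¹ := by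
  rw [PowerSeries.coeff_exp]
  simp

theorem tendsto_coeff_one_add_pow (j : ℕ) :
    Tendsto (fun n : ℕ => ((1 + C (n : ℂ)⁻¹ * X) ^ n : ℂ[X]).coeff j) atTop
      (𝓝 (PowerSeries.coeff j (PowerSeries.exp ℂ))) := by
  have hcoeff : ∀ n : ℕ, ((1 + C (n : ℂ)⁻¹ * X) ^ n : ℂ[X]).coeff j =
      (((n.choose j : ℝ) * ((n : ℝ)⁻¹) ^ j : ℝ) : ℂ) := by
    intro n
    have h : ((1 + C (n : ℂ)⁻¹ * X) ^ n : ℂ[X]) = ((1 + X) ^ n).comp (C (n : ℂ)⁻¹ * X) := by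
      simp
    rw [h, comp_C_mul_X_coeff, coeff_one_add_X_pow]
    push_cast
    rfl
  simp only [hcoeff]
  have hlim : Tendsto (fun n : ℕ => (n : ℝ) * (n : ℝ)⁻¹) atTop (𝓝 1) := by
    refine tendsto_const_nhds.congr' ?_
    filter_upwards [eventually_ge_atTop 1] with n hn
    rw [mul_inv_cancel₀ (Nat.cast_ne_zero.2 (by omega))]
  have h := ProbabilityTheory.tendsto_choose_mul_pow_atTop j hlim
  have h2 := (Complex.continuous_ofReal.tendsto _).comp h
  rw [coeff_exp_complex]
  simpa [Function.comp_def] using h2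

theorem hasSum_coeff_X_pow_mul_exp_pow (s b : ℕ) (y : ℂ) :
    HasSum (fun i => PowerSeries.coeff i (PowerSeries.X ^ s * PowerSeries.exp ℂ ^ b) * y ^ i)
      (y ^ s * Complex.exp y ^ b) := by
  induction s with
  | zero =>
    have h := NormedSpace.expSeries_div_hasSum_exp ((b : ℂ) * y)
    rw [← Complex.exp_eq_exp_ℂ, Complex.exp_nat_mul] at h
    simp only [pow_zero, one_mul]
    refine h.congr_fun ?_
    intro i
    rw [PowerSeries.exp_pow_eq_rescale_exp, PowerSeries.coeff_rescale, coeff_exp_complex,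
      mul_pow]
    ring
  | succ s ih =>
    rw [← hasSum_nat_add_iff' 1]
    simp only [pow_succ', mul_assoc, PowerSeries.coeff_succ_X_mul, Finset.sum_range_one,
      PowerSeries.coeff_zero_X_mul, zero_mul, sub_zero]
    refine (ih.mul_left y).congr_fun ?_
    intro i
    ring

/-- This is the algebraic independence of `y` and `exp y`: periodicity separates the powers of `y`,
then surjectivity of `exp` onto the nonzero numbers separates the powers of `exp y`. -/
theorem indepBelow_exp (d : ℕ) : IndepBelow (PowerSeries.exp ℂ) d := by
  rw [IndepBelow, Fintype.linearIndependent_iff]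
  intro g hg t
  have hfun : ∀ y : ℂ, ∑ t : lowIndex d,
      g t * (y ^ (t.1.1 + t.1.2) * Complex.exp y ^ t.1.2) = 0 := by
    intro y
    have h := hasSum_sum (s := Finset.univ) fun (t : lowIndex d) _ =>
      (hasSum_coeff_X_pow_mul_exp_pow (t.1.1 + t.1.2) t.1.2 y).mul_left (g t)
    refine h.unique ?_
    convert hasSum_zero using 2 with i
    have h2 := congrArg (PowerSeries.coeff i) hg
    simp only [map_sum, map_smul, smul_eq_mul, map_zero] at h2
    simp only [← mul_assoc, ← Finset.sum_mul, h2, zero_mul]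
  -- Freeze `exp y`: the resulting polynomial vanishes at all `y + 2πik`.
  have hpoly : ∀ y : ℂ, ∑ t : lowIndex d,
      monomial (t.1.1 + t.1.2) (g t * Complex.exp y ^ t.1.2) = (0 : ℂ[X]) := by
    intro y
    refine eq_zero_of_infinite_isRoot _ (Set.infinite_of_injective_forall_mem
      (f := fun k : ℕ => y + k * (2 * Real.pi * Complex.I)) ?_ fun k => ?_)
    · intro k l hkl
      have := mul_right_cancel₀ Complex.two_pi_I_ne_zero (add_left_cancel hkl)
      exact_mod_cast this
    · have h := hfun (y + k * (2 * Real.pi * Complex.I))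
      rw [Complex.exp_periodic.nat_mul k y] at h
      rw [Set.mem_ofPred_eq, IsRoot, eval_finsetSum, ← h]
      refine Finset.sum_congr rfl fun t _ => ?_
      rw [eval_monomial]
      ring
  have hpoly2 : ∑ u : lowIndex d,
      (if u.1.1 + u.1.2 = t.1.1 + t.1.2 then monomial u.1.2 (g u) else 0) = (0 : ℂ[X]) := by
    refine eq_zero_of_infinite_isRoot _ ((Set.finite_singleton (0 : ℂ)).infinite_compl.mono ?_)
    intro x hx
    have h := congrArg (fun p => p.coeff (t.1.1 + t.1.2)) (hpoly (Complex.log x))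
    simp only [finsetSum_coeff, coeff_monomial, Complex.exp_log hx, coeff_zero] at h
    rw [Set.mem_ofPred_eq, IsRoot, eval_finsetSum, ← h]
    refine Finset.sum_congr rfl fun u _ => ?_
    split_ifs <;> simp
  have h := congrArg (fun p => p.coeff t.1.2) hpoly2
  simp only [finsetSum_coeff, coeff_zero] at h
  rw [Finset.sum_eq_single t] at h
  · simpa using h
  · intro u _ hu
    split_ifs with hs
    · rw [coeff_monomial, if_neg]
      intro hb
      refine hu (Subtype.ext (Prod.ext ?_ hb))
      omega
    · simp
  · exact fun h => absurd (Finset.mem_univ t) h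

end Families

/-! ### The inductive construction and the limit norm. -/

section Construction
open Filter Topology
open scoped NNReal

/-- One step of the construction: both a multiple of a power of `X` and some `X (1 + X) ^ n` are
brought close to the polynomial `q`. -/
theorem IsTruncated.exists_next {d : ℕ} {ρ : Seminorm ℂ ℂ[X]} (hρ : IsTruncated d ρ)
    {q : ℂ[X]} (hq : q.coeff 0 = 0) {θ : ℝ} (hθ : 0 < θ) {r : ℝ} (hr : 1 < r) :
    ∃ d' ρ', d < d' ∧ IsTruncated d' ρ' ∧
      (∀ p : ℂ[X], p.natDegree < d → p.coeff 0 = 0 → ρ' p ≤ ρ p) ∧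
      (∀ p : ℂ[X], p.natDegree < d → ρ p ≤ r * ρ' p) ∧
      (∃ (c : ℂ) (N : ℕ), 1 ≤ N ∧ (C c * X ^ N - q).natDegree < d' ∧
        ρ' (C c * X ^ N - q) ≤ θ) ∧
      (∃ n : ℕ, 1 ≤ n ∧ (X * (1 + X) ^ n - q).natDegree < d' ∧
        ρ' (X * (1 + X) ^ n - q) ≤ θ) := by
  lift θ to ℝ≥0 using hθ.le
  have hθ' : 0 < θ := hθ
  -- Two perturbations are made, each allowed a loss of `√r`.
  have hs : 1 < √r := Real.lt_sqrt_of_sq_lt (by simpa using hr)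
  have hss : √r * √r = r := Real.mul_self_sqrt (by linarith)
  obtain ⟨n, hn⟩ := (hρ.eventually_exists_perturbation (indepBelow_X_pow d)
    (P := fun _ => X ^ d) (fun j => by simp [PowerSeries.coeff_X_pow, coeff_X_pow])
    hq hθ' (sub_pos.2 hs)).exists
  simp only [scaledGen_X_pow, add_sub_cancel] at hn
  set u := C ((n : ℂ) ^ d) * X ^ (d + 1) - q with hu
  have hu0 : u.coeff 0 = 0 := by simp [hu, hq]
  -- The order exceeds `u.natDegree`, so the second perturbation cannot increase the value of `u`.
  obtain ⟨d₁, ρ₁, hd₁, hρ₁, hle₁, hge₁, hu₁⟩ := hn (max (d + 1) (u.natDegree + 1))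
  obtain ⟨m, hm, hm1⟩ := ((hρ₁.eventually_exists_perturbation (indepBelow_exp d₁)
    tendsto_coeff_one_add_pow hq hθ' (sub_pos.2 hs)).and (eventually_ge_atTop 1)).exists
  rw [scaledGen_one_add_pow (by omega)] at hm
  simp only [add_sub_cancel] at hm
  set v := X * (1 + X) ^ m - q with hv
  obtain ⟨d₂, ρ₂, hd₂, hρ₂, hle₂, hge₂, hv₂⟩ := hm (max d₁ (v.natDegree + 1))
  have h1 := le_of_max_le_left hd₁
  have h2 := le_of_max_le_right hd₁
  have h3 := le_of_max_le_left hd₂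
  have h4 := le_of_max_le_right hd₂
  refine ⟨d₂, ρ₂, by omega, hρ₂, fun p hp hp0 => ?_, fun p hp => ?_,
    ⟨(n : ℂ) ^ d, d + 1, by omega, (show u.natDegree < d₂ by omega), ?_⟩,
    ⟨m, hm1, (show v.natDegree < d₂ by omega), hv₂⟩⟩
  · exact (hle₂ p (by omega) hp0).trans (hle₁ p hp hp0)
  · refine (hge₁ p hp).trans ?_
    rw [show r * ρ₂ p = √r * (√r * ρ₂ p) by rw [← mul_assoc, hss]]
    exact mul_le_mul_of_nonneg_left (hge₂ p (by omega)) (by positivity)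
  · exact (hle₂ u (by omega) hu0).trans hu₁

theorem isTruncated_one : ∃ ρ, IsTruncated 1 ρ := by
  refine ⟨(normSeminorm ℂ ℂ).comp (lcoeff ℂ 0), ⟨fun x y => ?_, fun p => ?_, 1, zero_le_one,
    fun p a ha => ?_⟩⟩
  · simp [Seminorm.comp_apply, mul_coeff_zero]
  · simp [Seminorm.comp_apply]
  · obtain rfl : a = 0 := by omega
    simp [Seminorm.comp_apply]

/-- A countable family of polynomials vanishing at `0`, dense for every seminorm. -/
noncomputable def denseTarget (s : Σ n : ℕ, Fin n → ℕ) : ℂ[X] :=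
  ∑ i : Fin s.1, C (TopologicalSpace.denseSeq ℂ (s.2 i)) * X ^ ((i : ℕ) + 1)

theorem denseTarget_coeff_zero (s : Σ n : ℕ, Fin n → ℕ) : (denseTarget s).coeff 0 = 0 := by
  simp [denseTarget, finsetSum_coeff]

/-- The weights `W` will be the norms of the monomials. They are arbitrary here because the targets
are enumerated before the norm exists. -/
theorem exists_denseTarget_near (W : ℕ → ℝ) {p : ℂ[X]} (hp : p.coeff 0 = 0) {ε : ℝ}
    (hε : 0 < ε) : ∃ (s : Σ n : ℕ, Fin n → ℕ) (a : Fin s.1 → ℂ),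
      p - denseTarget s = ∑ i, C (a i) * X ^ ((i : ℕ) + 1) ∧
        ∑ i, ‖a i‖ * |W i| ≤ ε := by
  set n := p.natDegree
  have hδ : 0 < ε / (∑ i : Fin n, |W i| + 1) := by positivity
  set δ := ε / (∑ i : Fin n, |W i| + 1) with hδd
  have hf : ∀ i : Fin n, ∃ j : ℕ,
      ‖p.coeff ((i : ℕ) + 1) - TopologicalSpace.denseSeq ℂ j‖ < δ := by
    intro i
    obtain ⟨j, hj⟩ := (TopologicalSpace.denseRange_denseSeq ℂ).exists_dist_lt
      (p.coeff ((i : ℕ) + 1)) hδ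
    exact ⟨j, by simpa [dist_eq_norm] using hj⟩
  choose f hf using hf
  refine ⟨⟨n, f⟩, fun i => p.coeff ((i : ℕ) + 1) - TopologicalSpace.denseSeq ℂ (f i), ?_, ?_⟩
  · have hsum : p = ∑ i : Fin n, C (p.coeff ((i : ℕ) + 1)) * X ^ ((i : ℕ) + 1) := by
      conv_lhs => rw [p.as_sum_range_C_mul_X_pow, Finset.sum_range_succ', hp]
      rw [C_0, zero_mul, add_zero,
        Finset.sum_range (fun i => C (p.coeff (i + 1)) * X ^ (i + 1))]
    conv_lhs => rw [hsum]
    simp only [denseTarget, ← Finset.sum_sub_distrib, C_sub, sub_mul]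
  · calc _ ≤ ∑ i : Fin n, δ * |W i| :=
          Finset.sum_le_sum fun i _ => mul_le_mul_of_nonneg_right (hf i).le (abs_nonneg _)
      _ = δ * ∑ i : Fin n, |W i| := by rw [Finset.mul_sum]
      _ ≤ δ * (∑ i : Fin n, |W i| + 1) :=
          mul_le_mul_of_nonneg_left (le_add_of_nonneg_right zero_le_one) hδ.le
      _ = ε := div_mul_cancel₀ _ (by positivity)

theorem exists_truncated_seq : ∃ (d : ℕ → ℕ) (ρ : ℕ → Seminorm ℂ ℂ[X]),
    (∀ k, IsTruncated (d k) (ρ k)) ∧ StrictMono d ∧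
    (∀ k (p : ℂ[X]), p.natDegree < d k → p.coeff 0 = 0 → ρ (k + 1) p ≤ ρ k p) ∧
    (∀ k (p : ℂ[X]), p.natDegree < d k →
      (2 - 1 / ((k : ℝ) + 1)) * ρ k p ≤ (2 - 1 / ((k : ℝ) + 1 + 1)) * ρ (k + 1) p) ∧
    ∀ s, ∀ e > 0, ∃ k,
      (∃ (c : ℂ) (N : ℕ), 1 ≤ N ∧ (C c * X ^ N - denseTarget s).natDegree < d k ∧
        ρ k (C c * X ^ N - denseTarget s) ≤ e) ∧
      (∃ n : ℕ, 1 ≤ n ∧ (X * (1 + X) ^ n - denseTarget s).natDegree < d k ∧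
        ρ k (X * (1 + X) ^ n - denseTarget s) ≤ e) := by
  -- Enumerates all pairs (target, tolerance).
  obtain ⟨σ, hσ⟩ := exists_surjective_nat ((Σ n : ℕ, Fin n → ℕ) × ℕ)
  have hγ : ∀ k : ℕ, 0 < 2 - 1 / ((k : ℝ) + 1) := by
    intro k
    have : 1 / ((k : ℝ) + 1) ≤ 1 := by
      rw [div_le_one (by positivity)]
      exact le_add_of_nonneg_left k.cast_nonneg
    linarith
  -- The permitted losses telescope, and `2 - 1 / (k + 1)` stays in `[1, 2)`, so the total loss is
  -- below `2`.
  have hratio : ∀ k : ℕ, 1 < (2 - 1 / ((k : ℝ) + 1 + 1)) / (2 - 1 / ((k : ℝ) + 1)) := by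
    intro k
    rw [one_lt_div (hγ k)]
    have : 1 / ((k : ℝ) + 1 + 1) < 1 / ((k : ℝ) + 1) :=
      one_div_lt_one_div_of_lt (by positivity) (lt_add_one _)
    linarith
  obtain ⟨ρ₀, hρ₀⟩ := isTruncated_one
  have hstep : ∀ (k : ℕ) (x : {x : ℕ × Seminorm ℂ ℂ[X] // IsTruncated x.1 x.2}),
      ∃ y : {x : ℕ × Seminorm ℂ ℂ[X] // IsTruncated x.1 x.2}, x.1.1 < y.1.1 ∧
      (∀ p : ℂ[X], p.natDegree < x.1.1 → p.coeff 0 = 0 → y.1.2 p ≤ x.1.2 p) ∧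
      (∀ p : ℂ[X], p.natDegree < x.1.1 → x.1.2 p ≤
        (2 - 1 / ((k : ℝ) + 1 + 1)) / (2 - 1 / ((k : ℝ) + 1)) * y.1.2 p) ∧
      (∃ (c : ℂ) (N : ℕ), 1 ≤ N ∧ (C c * X ^ N - denseTarget (σ k).1).natDegree < y.1.1 ∧
        y.1.2 (C c * X ^ N - denseTarget (σ k).1) ≤ 1 / (((σ k).2 : ℝ) + 1)) ∧
      (∃ n : ℕ, 1 ≤ n ∧ (X * (1 + X) ^ n - denseTarget (σ k).1).natDegree < y.1.1 ∧
        y.1.2 (X * (1 + X) ^ n - denseTarget (σ k).1) ≤ 1 / (((σ k).2 : ℝ) + 1)) := by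
    intro k x
    obtain ⟨d', ρ', h1, h2, h3⟩ := x.2.exists_next (denseTarget_coeff_zero (σ k).1)
      (Nat.one_div_pos_of_nat (n := (σ k).2)) (hratio k)
    exact ⟨⟨(d', ρ'), h2⟩, h1, h3⟩
  choose f hf using hstep
  let x : ℕ → {x : ℕ × Seminorm ℂ ℂ[X] // IsTruncated x.1 x.2} :=
    fun k => Nat.rec ⟨(1, ρ₀), hρ₀⟩ f k
  have hx : ∀ k, x (k + 1) = f k (x k) := fun k => rfl
  refine ⟨fun k => (x k).1.1, fun k => (x k).1.2, fun k => (x k).2,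
    strictMono_nat_of_lt_succ fun k => ?_, fun k => ?_, fun k p hp => ?_, fun s e he => ?_⟩
  · exact (hf k (x k)).1
  · exact (hf k (x k)).2.1
  · have h := (hf k (x k)).2.2.1 p hp
    rw [← hx, div_mul_eq_mul_div, le_div_iff₀ (hγ k)] at h
    linarith
  · obtain ⟨m, hm⟩ := exists_nat_one_div_lt he
    obtain ⟨k, hk⟩ := hσ (s, m)
    obtain ⟨-, -, -, ⟨c, N, hN, hdeg, hle⟩, ⟨n, hn, hdeg', hle'⟩⟩ := hf k (x k)
    rw [hk] at hdeg hle hdeg' hle'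
    refine ⟨k + 1, ⟨c, N, hN, ?_, ?_⟩, ⟨n, hn, ?_, ?_⟩⟩
    · exact hdeg
    · exact hle.trans hm.le
    · exact hdeg'
    · exact hle'.trans hm.le

theorem mem_polyZero_iff {p : ℂ[X]} : p ∈ polyZero ↔ p.coeff 0 = 0 := by
  rw [coeff_zero_eq_eval_zero]
  rfl

/-- The norm on `zℂ[z]` in whose completion `z` is chaotic. -/
theorem exists_chaotic_ringNorm : ∃ π : RingNorm polyZero,
    (∀ (c : ℂ) (p : polyZero), π (c • p) = ‖c‖ * π p) ∧
    (∀ (p : polyZero), ∀ e > 0, ∃ (c : ℂ) (N : ℕ) (u : polyZero), 1 ≤ N ∧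
      (u : ℂ[X]) = C c * X ^ N ∧ π (u - p) < e) ∧
    (∀ (p : polyZero), ∀ e > 0, ∃ (n : ℕ) (u : polyZero), 1 ≤ n ∧
      (u : ℂ[X]) = X * (1 + X) ^ n ∧ π (u - p) < e) := by
  obtain ⟨d, ρ, htr, hd, hanti, hmono, htarget⟩ := exists_truncated_seq
  have hle : ∀ k (p : ℂ[X]), p.natDegree < d k → p.coeff 0 = 0 → ∀ m, k ≤ m →
      ρ m p ≤ ρ k p := by
    intro k p hp hp0 m hm
    induction m, hm using Nat.le_induction with
    | base => exact le_rfl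
    | succ m hm ih => exact (hanti m p (hp.trans_le (hd.monotone hm)) hp0).trans ih
  have hge : ∀ k (p : ℂ[X]), p.natDegree < d k → ∀ m, k ≤ m → ρ k p ≤ 2 * ρ m p := by
    intro k p hp m hm
    have h : (2 - 1 / ((k : ℝ) + 1)) * ρ k p ≤ (2 - 1 / ((m : ℝ) + 1)) * ρ m p := by
      induction m, hm using Nat.le_induction with
      | base => exact le_rfl
      | succ m hm ih =>
        refine ih.trans ((hmono m p (hp.trans_le (hd.monotone hm))).trans_eq ?_)
        push_cast
        rfl
    have h1 : 1 / ((k : ℝ) + 1) ≤ 1 := by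
      rw [div_le_one (by positivity)]
      exact le_add_of_nonneg_left k.cast_nonneg
    have h2 : 0 ≤ 1 / ((m : ℝ) + 1) := by positivity
    nlinarith [apply_nonneg (ρ k) p, apply_nonneg (ρ m) p]
  have hdeg : ∀ p : ℂ[X], p.natDegree < d (p.natDegree + 1) := fun p =>
    (Nat.lt_succ_self _).trans_le (hd.le_apply)
  have hlim : ∀ p : polyZero, ∃ l, Tendsto (fun k => ρ k p) atTop (𝓝 l) := by
    intro p
    have hp0 := mem_polyZero_iff.1 p.2
    set N := (p : ℂ[X]).natDegree + 1
    have h1 : Antitone fun k => ρ (k + N) (p : ℂ[X]) := by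
      refine antitone_nat_of_succ_le fun k => ?_
      rw [add_right_comm]
      exact hanti (k + N) p ((hdeg p).trans_le (hd.monotone (Nat.le_add_left _ _))) hp0
    have h2 := tendsto_atTop_ciInf h1 ⟨0, by rintro _ ⟨k, rfl⟩; exact apply_nonneg _ _⟩
    exact ⟨_, (tendsto_add_atTop_iff_nat N).1 h2⟩
  choose L hL using hlim
  have hLle : ∀ (p : polyZero) k, (p : ℂ[X]).natDegree < d k → L p ≤ ρ k p := by
    intro p k hp
    refine le_of_tendsto (hL p) ?_
    filter_upwards [eventually_ge_atTop k] with m hm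
    exact hle k p hp (mem_polyZero_iff.1 p.2) m hm
  have hadd : ∀ p q, L (p + q) ≤ L p + L q := fun p q =>
    le_of_tendsto_of_tendsto' (hL _) ((hL p).add (hL q)) fun k => map_add_le_add (ρ k) _ _
  let π : RingNorm polyZero :=
    { toFun := L
      map_zero' := tendsto_nhds_unique (hL 0) (by simp)
      add_le' := hadd
      neg' := fun p => tendsto_nhds_unique (hL (-p)) (by simpa using hL p)
      mul_le' := fun p q => le_of_tendsto_of_tendsto' (hL _) ((hL p).mul (hL q)) fun k =>
        (htr k).submul _ _
      eq_zero_of_map_eq_zero' := by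
        intro p hp
        set N := (p : ℂ[X]).natDegree + 1
        -- The bounded total loss is what makes the limit definite.
        have h1 : ρ N (p : ℂ[X]) ≤ 2 * L p := by
          refine ge_of_tendsto ((hL p).const_mul 2) ?_
          filter_upwards [eventually_ge_atTop N] with m hm
          exact hge N p (hdeg p) m hm
        have h2 : L p = 0 := hp
        have h3 : ρ N (p : ℂ[X]) = 0 := le_antisymm (by linarith) (apply_nonneg _ _)
        obtain ⟨C, -, hC⟩ := (htr N).exists_coeff_le
        refine Subtype.ext (Polynomial.ext fun a => ?_)
        by_cases ha : a < d N
        · have := hC p a ha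
          rw [h3, mul_zero] at this
          simpa using this
        · have : (p : ℂ[X]).natDegree < a := (hdeg p).trans_le (not_lt.1 ha)
          simpa using coeff_eq_zero_of_natDegree_lt this }
  have hπ : ∀ p, π p = L p := fun p => rfl
  have hsmul : ∀ (c : ℂ) (p : polyZero), L (c • p) = ‖c‖ * L p := fun c p =>
    tendsto_nhds_unique (hL _) (by
      simpa [map_smul_eq_mul] using (hL p).const_mul ‖c‖)
  have hnear : ∀ (p : polyZero), ∀ e > 0, ∃ s, ∃ t : polyZero, (t : ℂ[X]) = denseTarget s ∧
      L (t - p) ≤ e := by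
    intro p e he
    have hX : ∀ i : ℕ, (X ^ (i + 1) : ℂ[X]) ∈ polyZero := fun i =>
      mem_polyZero_iff.2 (by simp)
    obtain ⟨s, a, hs, hsum⟩ := exists_denseTarget_near (fun i => L ⟨X ^ (i + 1), hX i⟩)
      (mem_polyZero_iff.1 p.2) he
    let t : polyZero := ⟨denseTarget s, mem_polyZero_iff.2 (denseTarget_coeff_zero s)⟩
    refine ⟨s, t, rfl, ?_⟩
    have h1 : t - p = ∑ i, (-a i) • (⟨X ^ ((i : ℕ) + 1), hX i⟩ : polyZero) := by
      have h2 : ∑ i, (-a i) • (⟨X ^ ((i : ℕ) + 1), hX i⟩ : polyZero) =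
          -∑ i, a i • (⟨X ^ ((i : ℕ) + 1), hX i⟩ : polyZero) := by
        simp [Finset.sum_neg_distrib]
      rw [h2, ← neg_sub, neg_inj]
      refine Subtype.ext ?_
      rw [NonUnitalSubalgebra.coe_sub, hs]
      simp [smul_eq_C_mul]
    rw [h1, ← hπ]
    refine le_trans (Finset.le_sum_of_subadditive π (map_zero π).le (map_add_le_add π) _ _) ?_
    refine le_trans (Finset.sum_le_sum fun i _ => ?_) hsum
    rw [hπ, hsmul, norm_neg]
    exact mul_le_mul_of_nonneg_left (le_abs_self _) (norm_nonneg _)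
  have htri : ∀ u t p : polyZero, ∀ e : ℝ, L (u - t) ≤ e / 3 → L (t - p) ≤ e / 3 → 0 < e →
      L (u - p) < e := by
    intro u t p e h1 h2 he
    have := hadd (u - t) (t - p)
    rw [sub_add_sub_cancel] at this
    linarith
  refine ⟨π, hsmul, fun p e he => ?_, fun p e he => ?_⟩
  · obtain ⟨s, t, ht, htp⟩ := hnear p (e / 3) (by positivity)
    obtain ⟨k, ⟨c, N, hN, hdeg, hle⟩, -⟩ := htarget s (e / 3) (by positivity)
    let u : polyZero := ⟨C c * X ^ N, mem_polyZero_iff.2 (by simp; omega)⟩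
    refine ⟨c, N, u, hN, rfl, htri u t p e ?_ htp he⟩
    rw [← ht] at hdeg hle
    exact (hLle (u - t) k hdeg).trans hle
  · obtain ⟨s, t, ht, htp⟩ := hnear p (e / 3) (by positivity)
    obtain ⟨k, -, ⟨n, hn, hdeg, hle⟩⟩ := htarget s (e / 3) (by positivity)
    let u : polyZero := ⟨X * (1 + X) ^ n, mem_polyZero_iff.2 (by simp)⟩
    refine ⟨n, u, hn, rfl, htri u t p e ?_ htp he⟩
    rw [← ht] at hdeg hle
    exact (hLle (u - t) k hdeg).trans hle

end Construction

/-! ### Density and infinite dimension through an isometric embedding. -/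

section Isometric

variable {A : Type*} [NonUnitalNormedCommRing A] [NormedSpace ℂ A] {ι : polyZero →ₙₐ[ℂ] A}
  {π : RingNorm polyZero}

theorem dense_of_approx (hι : ∀ p, ‖ι p‖ = π p) (hd : DenseRange ι) {S : Set A}
    (hS : ∀ p : polyZero, ∀ e > 0, ∃ u : polyZero, ι u ∈ S ∧ π (u - p) < e) : Dense S := by
  rw [Metric.dense_iff]
  intro x r hr
  obtain ⟨p, hp⟩ := hd.exists_dist_lt x (half_pos hr)
  obtain ⟨u, hu, hup⟩ := hS p (r / 2) (half_pos hr)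
  refine ⟨ι u, ?_, hu⟩
  rw [← hι, map_sub, ← dist_eq_norm] at hup
  rw [Metric.mem_ball]
  linarith [dist_triangle (ι u) (ι p) x, dist_comm x (ι p)]

theorem not_finiteDimensional_of_isometry (hι : ∀ p, ‖ι p‖ = π p) : ¬ FiniteDimensional ℂ A := by
  intro hfin
  let f : ℂ[X] →ₗ[ℂ] A :=
    { toFun := fun p => ι ⟨X * p, mem_polyZero_iff.2 (by simp)⟩
      map_add' := fun p q => by
        rw [← map_add]
        congr 1
        exact Subtype.ext (mul_add _ _ _)
      map_smul' := fun c p => by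
        rw [← map_smul]
        congr 1
        exact Subtype.ext (mul_smul_comm _ _ _) }
  have hf : Function.Injective f := by
    rw [← LinearMap.ker_eq_bot, LinearMap.ker_eq_bot']
    intro p hp
    have h1 : π ⟨X * p, mem_polyZero_iff.2 (by simp)⟩ = 0 := by
      rw [← hι]
      exact norm_eq_zero.2 hp
    have h2 : X * p = 0 := congrArg Subtype.val (eq_zero_of_map_eq_zero π h1)
    simpa using h2
  exact Polynomial.not_finite (Module.Finite.of_injective f hf)

end Isometric

/-! ### Absence of a unit, and chaoticity of the image of `z`. -/

section Abstract

variable {A : Type*} [NonUnitalNormedCommRing A] [NormedSpace ℂ A]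
  [IsScalarTower ℂ A A] [SMulCommClass ℂ A A]

theorem exists_character_of_unit [CompleteSpace A] [Nontrivial A] {e : A}
    (he : ∀ x : A, e * x = x ∧ x * e = x) :
    ∃ χ : A →L[ℂ] ℂ, (∀ x y, χ (x * y) = χ x * χ y) ∧ χ e = 1 := by
  let _ : NormedCommRing A :=
    { ‹NonUnitalNormedCommRing A› with
      one := e
      one_mul := fun x => (he x).1
      mul_one := fun x => (he x).2 }
  let _ : Algebra ℂ A := Algebra.ofModule smul_mul_assoc fun c x y => mul_smul_comm c x y
  let _ : NormedAlgebra ℂ A := ⟨norm_smul_le⟩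
  obtain ⟨φ⟩ : Nonempty (WeakDual.characterSpace ℂ A) := inferInstance
  exact ⟨WeakDual.CharacterSpace.toCLM φ, fun x y => map_mul φ x y, map_one φ⟩

/-- If `‖1 + s‖ ≤ 1` the orbit is bounded; otherwise it stays at distance at least `‖s‖ > 0` from
`0`. -/
theorem not_dense_one_add_pow_mul (s : ℂ) :
    ¬ Dense {w : ℂ | ∃ n : ℕ, w = (1 + s) ^ n * s} := by
  intro h
  rcases le_or_gt ‖1 + s‖ 1 with h1 | h1
  · obtain ⟨w, hw, n, rfl⟩ := Metric.dense_iff.1 h ((‖s‖ + 1 : ℝ) : ℂ) 1 one_pos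
    rw [Metric.mem_ball, dist_comm, dist_eq_norm] at hw
    have h2 : ‖(1 + s) ^ n * s‖ ≤ ‖s‖ := by
      rw [norm_mul, norm_pow]
      exact mul_le_of_le_one_left (norm_nonneg s) (pow_le_one₀ (norm_nonneg _) h1)
    have h3 := norm_sub_norm_le ((‖s‖ + 1 : ℝ) : ℂ) ((1 + s) ^ n * s)
    rw [Complex.norm_real, Real.norm_of_nonneg (by positivity)] at h3
    linarith
  · have hs : 0 < ‖s‖ := by
      rw [norm_pos_iff]
      rintro rfl
      simp at h1
    obtain ⟨w, hw, n, rfl⟩ := Metric.dense_iff.1 h 0 ‖s‖ hs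
    rw [mem_ball_zero_iff, norm_mul, norm_pow] at hw
    exact hw.not_ge (le_mul_of_one_le_left hs.le (one_le_pow₀ h1.le))

/-- A nontrivial commutative Banach algebra with an almost hypercyclic element has no unit. -/
theorem IsAlmostHypercyclicElement.not_exists_unit [CompleteSpace A] [Nontrivial A] {a : A}
    (ha : IsAlmostHypercyclicElement a) : ¬ ∃ e : A, ∀ x : A, e * x = x ∧ x * e = x := by
  rintro ⟨e, he⟩
  obtain ⟨χ, hmul, hone⟩ := exists_character_of_unit he
  -- `χ` lives on `A`, not on the unitization, so the orbit is followed inside `A` by `x ↦ x + a *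
  -- x`.
  have hrec : ∀ n : ℕ, ∃ x : A, (Unitization.inr x : Unitization ℂ A) =
      (1 + Unitization.inr a) ^ n * Unitization.inr a ∧ χ x = (1 + χ a) ^ n * χ a := by
    intro n
    induction n with
    | zero => exact ⟨a, by simp, by simp⟩
    | succ n ih =>
      obtain ⟨x, hx, hχ⟩ := ih
      refine ⟨x + a * x, ?_, ?_⟩
      · rw [Unitization.inr_add, Unitization.inr_mul, hx]
        ring
      · rw [map_add, hmul, hχ]
        ring
  have hsurj : Function.Surjective χ := fun z => ⟨z • e, by simp [hone]⟩
  refine not_dense_one_add_pow_mul (χ a) ?_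
  refine (hsurj.denseRange.dense_image χ.continuous ha).mono ?_
  rintro _ ⟨x, ⟨n, -, hx⟩, rfl⟩
  obtain ⟨y, hy, hχ⟩ := hrec n
  rw [← hy] at hx
  exact ⟨n, by rw [Unitization.inr_injective hx, hχ]⟩

variable (ι : polyZero →ₙₐ[ℂ] A)

theorem inr_map_eq_pow (n : ℕ) : ∀ u : polyZero, (u : ℂ[X]) = X ^ (n + 1) →
    (Unitization.inr (ι u) : Unitization ℂ A) = Unitization.inr (ι polyZ) ^ (n + 1) := by
  induction n with
  | zero =>
    intro u hu
    have : u = polyZ := Subtype.ext (show (u : ℂ[X]) = X by simpa using hu)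
    rw [this, zero_add, pow_one]
  | succ n ih =>
    intro u hu
    let v : polyZero := ⟨X ^ (n + 1), mem_polyZero_iff.2 (by simp)⟩
    have : u = v * polyZ := Subtype.ext (by rw [hu, pow_succ]; rfl)
    rw [this, map_mul, Unitization.inr_mul, ih v rfl, ← pow_succ]

theorem inr_map_eq_one_add_pow_mul (n : ℕ) : ∀ u : polyZero, (u : ℂ[X]) = X * (1 + X) ^ n →
    (Unitization.inr (ι u) : Unitization ℂ A) =
      (1 + Unitization.inr (ι polyZ)) ^ n * Unitization.inr (ι polyZ) := by
  induction n with
  | zero =>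
    intro u hu
    have : u = polyZ := Subtype.ext (show (u : ℂ[X]) = X by simpa using hu)
    rw [this, pow_zero, one_mul]
  | succ n ih =>
    intro u hu
    let v : polyZero := ⟨X * (1 + X) ^ n, mem_polyZero_iff.2 (by simp)⟩
    have : u = v + polyZ * v := Subtype.ext (by
      rw [hu]
      change _ = X * (1 + X) ^ n + X * (X * (1 + X) ^ n)
      ring)
    rw [this, map_add, map_mul, Unitization.inr_add, Unitization.inr_mul, ih v rfl]
    ring

variable {ι} {π : RingNorm polyZero}

theorem isChaoticElement_polyZ (hι : ∀ p, ‖ι p‖ = π p) (hd : DenseRange ι)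
    (h₁ : ∀ (p : polyZero), ∀ e > 0, ∃ (c : ℂ) (N : ℕ) (u : polyZero), 1 ≤ N ∧
      (u : ℂ[X]) = C c * X ^ N ∧ π (u - p) < e)
    (h₂ : ∀ (p : polyZero), ∀ e > 0, ∃ (n : ℕ) (u : polyZero), 1 ≤ n ∧
      (u : ℂ[X]) = X * (1 + X) ^ n ∧ π (u - p) < e) :
    IsChaoticElement (ι polyZ) := by
  refine ⟨dense_of_approx hι hd fun p e he => ?_, dense_of_approx hι hd fun p e he => ?_⟩
  · obtain ⟨c, N, u, hN, hu, hlt⟩ := h₁ p e he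
    obtain ⟨k, rfl⟩ := Nat.exists_eq_add_of_le' hN
    let v : polyZero := ⟨X ^ (k + 1), mem_polyZero_iff.2 (by simp)⟩
    have huv : u = c • v := Subtype.ext (by rw [hu, ← smul_eq_C_mul]; rfl)
    refine ⟨u, ⟨c, k + 1, hN, ?_⟩, hlt⟩
    rw [huv, map_smul, Unitization.inr_smul, inr_map_eq_pow ι k v rfl]
  · obtain ⟨n, u, hn, hu, hlt⟩ := h₂ p e he
    exact ⟨u, ⟨n, hn, inr_map_eq_one_add_pow_mul ι n u hu⟩, hlt⟩

end Abstract

/-! ### Completion of `zℂ[z]`, taken inside a unital completion of `ℂ[z]`. -/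

section Completion

/-- The part of a polynomial vanishing at `0`. -/
noncomputable def zeroPart (p : ℂ[X]) : polyZero :=
  ⟨p - C (p.coeff 0), mem_polyZero_iff.2 (by simp)⟩

theorem coe_zeroPart (p : ℂ[X]) : (zeroPart p : ℂ[X]) = p - C (p.coeff 0) := rfl

theorem zeroPart_coe (p : polyZero) : zeroPart (p : ℂ[X]) = p :=
  Subtype.ext (by rw [coe_zeroPart, mem_polyZero_iff.1 p.2, C_0, sub_zero])

theorem zeroPart_add (p q : ℂ[X]) : zeroPart (p + q) = zeroPart p + zeroPart q :=
  Subtype.ext (by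
    change p + q - C ((p + q).coeff 0) = (p - C (p.coeff 0)) + (q - C (q.coeff 0))
    rw [coeff_add, C_add]
    ring)

theorem zeroPart_smul (c : ℂ) (p : ℂ[X]) : zeroPart (c • p) = c • zeroPart p :=
  Subtype.ext (by
    change c • p - C ((c • p).coeff 0) = c • (p - C (p.coeff 0))
    rw [coeff_smul, smul_sub, ← smul_C])

theorem zeroPart_mul (p q : ℂ[X]) :
    zeroPart (p * q) = p.coeff 0 • zeroPart q + q.coeff 0 • zeroPart p +
      zeroPart p * zeroPart q :=
  Subtype.ext (by
    change p * q - C ((p * q).coeff 0) = p.coeff 0 • (q - C (q.coeff 0)) +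
      q.coeff 0 • (p - C (p.coeff 0)) + (p - C (p.coeff 0)) * (q - C (q.coeff 0))
    rw [mul_coeff_zero, C_mul, smul_eq_C_mul, smul_eq_C_mul]
    ring)

/-- The extension of a homogeneous ring norm on `zℂ[z]` to `ℂ[z]`. -/
noncomputable def unitalExtension (π : RingNorm polyZero)
    (hπ : ∀ (c : ℂ) (p : polyZero), π (c • p) = ‖c‖ * π p) : RingNorm ℂ[X] where
  toFun p := ‖p.coeff 0‖ + π (zeroPart p)
  map_zero' := by
    have : zeroPart 0 = 0 := Subtype.ext (by simp [coe_zeroPart])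
    simp [this]
  add_le' p q := by
    rw [zeroPart_add, coeff_add]
    linarith [norm_add_le (p.coeff 0) (q.coeff 0), map_add_le_add π (zeroPart p) (zeroPart q)]
  neg' p := by
    have : zeroPart (-p) = -zeroPart p := by
      rw [← neg_one_smul ℂ p, zeroPart_smul, neg_one_smul]
    rw [this, coeff_neg, norm_neg, map_neg_eq_map]
  mul_le' p q := by
    have h1 := map_add_le_add π (p.coeff 0 • zeroPart q + q.coeff 0 • zeroPart p)
      (zeroPart p * zeroPart q)
    have h2 := map_add_le_add π (p.coeff 0 • zeroPart q) (q.coeff 0 • zeroPart p)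
    have h3 := map_mul_le_mul π (zeroPart p) (zeroPart q)
    rw [hπ, hπ] at h2
    rw [zeroPart_mul, mul_coeff_zero, norm_mul]
    nlinarith
  eq_zero_of_map_eq_zero' p hp := by
    have h1 : ‖p.coeff 0‖ + π (zeroPart p) = 0 := hp
    have h2 := apply_nonneg π (zeroPart p)
    have h3 := norm_nonneg (p.coeff 0)
    have h4 : p.coeff 0 = 0 := norm_eq_zero.1 (by linarith)
    have h5 : zeroPart p = 0 := eq_zero_of_map_eq_zero π (by linarith)
    have h6 := congrArg Subtype.val h5
    rw [coe_zeroPart, h4, C_0, sub_zero] at h6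
    exact h6

theorem unitalExtension_coe (π : RingNorm polyZero)
    (hπ : ∀ (c : ℂ) (p : polyZero), π (c • p) = ‖c‖ * π p) (p : polyZero) :
    unitalExtension π hπ p = π p := by
  change ‖(p : ℂ[X]).coeff 0‖ + π (zeroPart p) = π p
  rw [zeroPart_coe, mem_polyZero_iff.1 p.2, norm_zero, zero_add]

theorem unitalExtension_smul (π : RingNorm polyZero)
    (hπ : ∀ (c : ℂ) (p : polyZero), π (c • p) = ‖c‖ * π p) (c : ℂ) (p : ℂ[X]) :
    unitalExtension π hπ (c • p) = ‖c‖ * unitalExtension π hπ p := by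
  change ‖(c • p).coeff 0‖ + π (zeroPart (c • p)) = ‖c‖ * (‖p.coeff 0‖ + π (zeroPart p))
  rw [zeroPart_smul, hπ, coeff_smul, norm_smul, mul_add]

theorem exists_isometric_hom (π : RingNorm polyZero)
    (hπ : ∀ (c : ℂ) (p : polyZero), π (c • p) = ‖c‖ * π p) :
    ∃ (R : Type) (_ : NormedCommRing R) (_ : NormedAlgebra ℂ R) (_ : CompleteSpace R)
      (j : polyZero →ₙₐ[ℂ] R), ∀ p, ‖j p‖ = π p := by
  let _ : NormedCommRing ℂ[X] := { (unitalExtension π hπ).toNormedRing with mul_comm := mul_comm }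
  let _ : NormedAlgebra ℂ ℂ[X] :=
    { (inferInstance : Algebra ℂ ℂ[X]) with
      norm_smul_le := fun c p => (unitalExtension_smul π hπ c p).le }
  refine ⟨UniformSpace.Completion ℂ[X], inferInstance, inferInstance, inferInstance,
    { toFun := fun p => ((p : ℂ[X]) : UniformSpace.Completion ℂ[X])
      map_smul' := fun c p => UniformSpace.Completion.coe_smul c (p : ℂ[X])
      map_zero' := UniformSpace.Completion.coe_zero
      map_add' := fun p q => UniformSpace.Completion.coe_add (p : ℂ[X]) (q : ℂ[X])
      map_mul' := fun p q => UniformSpace.Completion.coe_mul (p : ℂ[X]) (q : ℂ[X]) },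
    fun p => ?_⟩
  exact (UniformSpace.Completion.norm_coe (p : ℂ[X])).trans (unitalExtension_coe π hπ p)

/-- A homogeneous ring norm on `zℂ[z]` has a completion. -/
theorem exists_completion (π : RingNorm polyZero)
    (hπ : ∀ (c : ℂ) (p : polyZero), π (c • p) = ‖c‖ * π p) :
    ∃ (A : Type) (_ : NonUnitalNormedCommRing A) (_ : NormedSpace ℂ A)
      (_ : IsScalarTower ℂ A A) (_ : SMulCommClass ℂ A A) (_ : CompleteSpace A)
      (ι : polyZero →ₙₐ[ℂ] A), (∀ p, ‖ι p‖ = π p) ∧ DenseRange ι := by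
  obtain ⟨R, _, _, _, j, hj⟩ := exists_isometric_hom π hπ
  -- The closure of the isometric image of `zℂ[z]` is complete and contains that image densely.
  let S : NonUnitalSubalgebra ℂ R := (NonUnitalAlgHom.range j).topologicalClosure
  have hS : ∀ p, j p ∈ S := fun p =>
    NonUnitalSubalgebra.le_topologicalClosure _ (NonUnitalAlgHom.mem_range_self j p)
  refine ⟨S, inferInstance, ⟨fun c x => norm_smul_le c (x : R)⟩, inferInstance, inferInstance,
    (NonUnitalSubalgebra.isClosed_topologicalClosure _).completeSpace_coe,
    NonUnitalAlgHom.codRestrict j S hS, hj, ?_⟩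
  rw [DenseRange, dense_iff_closure_eq, Set.eq_univ_iff_forall]
  intro x
  rw [closure_subtype, ← Set.range_comp]
  exact x.2

end Completion

theorem theorem1p2 :
    ∃ (π : RingNorm polyZero) (A : Type) (_ : NonUnitalNormedCommRing A) (_ : NormedSpace ℂ A)
      (_ : IsScalarTower ℂ A A) (_ : SMulCommClass ℂ A A) (_ : CompleteSpace A)
      (ι : polyZero →ₙₐ[ℂ] A),
      (∀ (c : ℂ) (p : polyZero), π (c • p) = ‖c‖ * π p) ∧
      (∀ p : polyZero, ‖ι p‖ = π p) ∧
      DenseRange ι ∧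
      ¬ FiniteDimensional ℂ A ∧
      (¬ ∃ e : A, ∀ x : A, e * x = x ∧ x * e = x) ∧
      IsChaoticElement (ι polyZ) := by
  obtain ⟨π, hπ, h₁, h₂⟩ := exists_chaotic_ringNorm
  obtain ⟨A, _, _, _, _, _, ι, hι, hd⟩ := exists_completion π hπ
  have hfin := not_finiteDimensional_of_isometry hι
  have hchaos := isChaoticElement_polyZ hι hd h₁ h₂
  have : Nontrivial A := by
    by_contra h
    rw [not_nontrivial_iff_subsingleton] at h
    exact hfin inferInstance
  exact ⟨π, A, _, _, inferInstance, inferInstance, inferInstance, ι, hπ, hι, hd, hfin,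
    hchaos.2.not_exists_unit, hchaos⟩
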